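/- An infinite binary image is a colouring $I$ of $\mathbb{Z}^2$ with the colours black and white. Its white pixel density is $$\rho(I)=\liminf_{j\to\infty,\ j\text{ odd}}\frac{\#\{\text{white pixels of } I \text{ in the } j\times j \text{ box centred at the origin}\}}{j^2}.$$ Two pixels are 4-adjacent if their $\ell_1$ distance is $1$, and 8-adjacent if their $\ell_\infty$ distance is $1$. For $\alpha\in\{4,8\}$, a white $\alpha$-connected component is a connected component of the graph whose vertices are the white pixels and whose edges join $\alpha$-adjacent white pixels. Let $\mathrm{maxCC}_\alpha(I)$ be the maximum size of a white $\alpha$-connected component of $I$ ($+\infty$ if there is no finite maximum; $0$ if $I$ has no white pixel), and for $d\in(0,1)$ let $$\mathcal{C}_\alpha(d)=\min\{\mathrm{maxCC}_\alpha(I): \rho(I)\ge d\},$$ the minimum being over all infinite binary images $I$. With $\mathbb{N}=\{1,2,3,\dots\}$ put, for $k\in\mathbb{N}$, $$F_8(k)=\max_{1\le j\le k}\frac{j}{j+\lceil 2\sqrt{j}\rceil+1},\qquad F_4(k)=\max_{1\le j\le k}\frac{j}{j+\frac12\lceil 2\sqrt{2j-1}\rceil},$$ and $F_\alpha^{-1}(d)=\min\{k\in\mathbb{N}:F_\alpha(k)\ge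 d\}$. For all $d\in(0,1)$ the minima defining $F_8^{-1}(d)$ and $F_4^{-1}(d)$ exist, and $$\mathcal{C}_8(d)=F_8^{-1}(d)\ge\frac{4}{(1-d)^2}-\frac{6}{1-d},\qquad \mathcal{C}_4(d)\ge F_4^{-1}(d)\ge\frac{2}{(1-d)^2}-\frac{4}{1-d}.$$ Moreover, $\mathcal{C}_4(d)$ has the following exact values: - $\mathcal{C}_4(d)=1$ for $d\in(0,\frac12]$; - $\mathcal{C}_4(d)=3$ for $d\in(\frac12,\frac{13}{24}]$; - $\mathcal{C}_4(d)=4$ for $d\in(\frac{13}{24},\frac47]$; - $\mathcal{C}_4(d)=5$ for $d\in(\frac47,\frac58]$; - $\mathcal{C}_4(d)=7$ for $d\in(\frac58,\frac7{11}]$; - $\mathcal{C}_4(d)=8$ for $d\in(\frac7{11},\frac23]$; - $\mathcal{C}_4(d)=10$ for $d\in(\frac23,\frac{61}{90}]$; - for every integer $n\ge2$, $\mathcal{C}_4(d)=F_4^{-1}(d)$ for $d\in\Big(\frac{4n^2-6n+2}{4n^2-2n-1},\frac{(n-1)^2+n^2}{2n^2}\Big]$; - for every integer $n\ge2$, $\mathcal{C}_4(d)=F_4^{-1}(d)$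 for $d\in\Big(\frac{4n^2-2n}{4n^2+2n-1},\frac{n}{n+1}\Big]$. -/

import Mathlib

/-!
An infinite binary image is a colouring of `ℤ × ℤ` by black and white; it is represented by
the set of its white pixels.
-/

namespace BinaryImage

/-- 4-adjacency: the `ℓ₁` distance is `1`. -/
def adj4 : SimpleGraph (ℤ × ℤ) where
  Adj x y := |x.1 - y.1| + |x.2 - y.2| = 1
  symm := ⟨fun x y h => by rw [abs_sub_comm y.1, abs_sub_comm y.2]; exact h⟩
  loopless := ⟨fun x h => by simp at h⟩

/-- 8-adjacency: the `ℓ∞` distance is `1`. -/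
def adj8 : SimpleGraph (ℤ × ℤ) where
  Adj x y := max |x.1 - y.1| |x.2 - y.2| = 1
  symm := ⟨fun x y h => by rw [abs_sub_comm y.1, abs_sub_comm y.2]; exact h⟩
  loopless := ⟨fun x h => by simp at h⟩

/-- The `(2n+1) × (2n+1)` box of pixels centred at the origin. -/
def box (n : ℕ) : Set (ℤ × ℤ) :=
  Set.Icc (-(n : ℤ)) n ×ˢ Set.Icc (-(n : ℤ)) n

/-- White pixel density of the image with white pixel set `W`: the lower limit, over odd
`j = 2n + 1`, of the proportion of white pixels in the centred `j × j` box. -/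
noncomputable def density (W : Set (ℤ × ℤ)) : ℝ :=
  Filter.liminf (fun n : ℕ => ((W ∩ box n).ncard : ℝ) / (2 * (n : ℝ) + 1) ^ 2) Filter.atTop

/-- The largest size of a white connected component, with respect to the adjacency `G`, of the
image with white pixel set `W`. It is `⊤` when there is no largest (finite) size, and `0` for
the all-black image. -/
noncomputable def maxCC (G : SimpleGraph (ℤ × ℤ)) (W : Set (ℤ × ℤ)) : ℕ∞ :=
  ⨆ c : (G.induce W).ConnectedComponent, c.supp.encard

/-- Maximum guaranteed component size: the minimum of `maxCC G W` over all infinite images of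
white pixel density at least `d`. (An infimum in `ℕ∞` over a nonempty set is a minimum.) -/
noncomputable def mgcs (G : SimpleGraph (ℤ × ℤ)) (d : ℝ) : ℕ∞ :=
  sInf {m : ℕ∞ | ∃ W : Set (ℤ × ℤ), d ≤ density W ∧ m = maxCC G W}

/-- `C₄(d)`. -/
noncomputable def C4 (d : ℝ) : ℕ∞ := mgcs adj4 d

/-- `C₈(d)`. -/
noncomputable def C8 (d : ℝ) : ℕ∞ := mgcs adj8 d

/-- `F₈(k) = max_{1 ≤ j ≤ k} j / (j + ⌈2√j⌉ + 1)`. -/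
noncomputable def F8 (k : ℕ) : ℝ :=
  sSup ((fun j : ℕ => (j : ℝ) / ((j : ℝ) + (⌈2 * Real.sqrt (j : ℝ)⌉ : ℝ) + 1)) '' Set.Icc 1 k)

/-- `F₄(k) = max_{1 ≤ j ≤ k} j / (j + ⌈2√(2j-1)⌉ / 2)`. -/
noncomputable def F4 (k : ℕ) : ℝ :=
  sSup ((fun j : ℕ =>
    (j : ℝ) / ((j : ℝ) + (⌈2 * Real.sqrt (2 * (j : ℝ) - 1)⌉ : ℝ) / 2)) '' Set.Icc 1 k)

/-- `F₈⁻¹(d) = min {k ≥ 1 : F₈(k) ≥ d}`. -/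
noncomputable def F8inv (d : ℝ) : ℕ := sInf {k : ℕ | 1 ≤ k ∧ d ≤ F8 k}

/-- `F₄⁻¹(d) = min {k ≥ 1 : F₄(k) ≥ d}`. -/
noncomputable def F4inv (d : ℝ) : ℕ := sInf {k : ℕ | 1 ≤ k ∧ d ≤ F4 k}

end BinaryImage

/-!
Every pixel lies in four `2 × 2` blocks, so the mean number of white pixels per block is four times
the density of white pixels.

For 8-adjacency a block meets at most one white component, and a component of `j` pixels meets at
least `j + ⌈2√j⌉ + 1` blocks by isoperimetry. For 4-adjacency the white pixels of a block with more
than two of them lie in one component. If the smallest diagonal rectangle around a component of `j`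
pixels has sides `m` and `n`, then `2j ≤ mn + 1` while the excesses over two in its blocks sum up
to at most `2j - m - n`, hence to at most `2j - ⌈2√(2j - 1)⌉`.

For components of at most three (at most six) pixels this is improved to the density bound `13/24`
(respectively `5/8`) by looking around an extremal component, an L-tromino (respectively a plus
with an added corner): near it there is a block with fewer than two white pixels, or a component
that wastes enough to compensate.

Conversely, the bounds are attained by lattice translates of rectangles, diagonal rectangles and
diamonds, and by two periodic patterns with `24` and `90` residues.
-/

namespace BinaryImage

open Filter Finset Topology

section BoxAverages

/-! ### Averages over large boxes -/

/-- The box `box n` as a finset. -/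
noncomputable def boxFinset (n : ℕ) : Finset (ℤ × ℤ) :=
  Icc (-(n : ℤ)) n ×ˢ Icc (-(n : ℤ)) n

theorem coe_boxFinset (n : ℕ) : (boxFinset n : Set (ℤ × ℤ)) = box n := by
  simp [boxFinset, box]

theorem mem_boxFinset {n : ℕ} {x : ℤ × ℤ} : x ∈ boxFinset n ↔ |x.1| ≤ n ∧ |x.2| ≤ n := by
  simp only [boxFinset, mem_product, mem_Icc, abs_le]

theorem card_Icc_neg_self (n : ℕ) : #(Icc (-(n : ℤ)) n) = 2 * n + 1 := by
  rw [Int.card_Icc]; lia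

theorem card_boxFinset (n : ℕ) : #(boxFinset n) = (2 * n + 1) ^ 2 := by
  rw [boxFinset, card_product, card_Icc_neg_self, sq]

/-- Pixels of a box within `ℓ∞` distance less than `k` of its boundary. -/
noncomputable def boxRim (n k : ℕ) : Finset (ℤ × ℤ) :=
  {x ∈ boxFinset n | (n : ℤ) < |x.1| + k ∨ (n : ℤ) < |x.2| + k}

theorem card_filter_lt_abs_add_le (n k : ℕ) :
    #{t ∈ Icc (-(n : ℤ)) n | (n : ℤ) < |t| + k} ≤ 2 * k := by
  have ends : {t ∈ Icc (-(n : ℤ)) n | (n : ℤ) < |t| + k} ⊆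
      Ioc ((n : ℤ) - k) n ∪ Ico (-(n : ℤ)) (-n + k) := by
    intro t ht
    simp only [mem_filter, mem_Icc] at ht
    simp only [mem_union, mem_Ioc, mem_Ico]
    rcases abs_cases t with h | h <;> lia
  calc _ ≤ #(Ioc ((n : ℤ) - k) n) + #(Ico (-(n : ℤ)) (-n + k)) :=
        (card_le_card ends).trans (card_union_le _ _)
    _ ≤ 2 * k := by rw [Int.card_Ioc, Int.card_Ico]; lia

theorem card_boxRim_le (n k : ℕ) : (#(boxRim n k) : ℝ) ≤ 8 * k * (n + 1) := by
  set side := Icc (-(n : ℤ)) n with hside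
  set ends := {t ∈ side | (n : ℤ) < |t| + k} with hends
  have hsub : boxRim n k ⊆ ends ×ˢ side ∪ side ×ˢ ends := by
    intro x hx
    simp only [boxRim, boxFinset, mem_filter, mem_product] at hx
    simp only [hends, mem_union, mem_product, mem_filter]
    tauto
  have hcard := (card_le_card hsub).trans (card_union_le _ _)
  rw [card_product, card_product, hside, card_Icc_neg_self] at hcard
  have hends_card : #ends ≤ 2 * k := card_filter_lt_abs_add_le n k
  exact_mod_cast (by nlinarith : #(boxRim n k) ≤ 8 * k * (n + 1))

/-- The sums of `f` over centred boxes exceed `0` by at most a multiple of the side length, so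
that all limit points of the averages of `f` over centred boxes are nonpositive. -/
def AvgNonpos (f : ℤ × ℤ → ℝ) : Prop :=
  ∃ C : ℝ, ∀ n : ℕ, ∑ x ∈ boxFinset n, f x ≤ C * (n + 1)

variable {f g : ℤ × ℤ → ℝ}

theorem AvgNonpos.mono (hg : AvgNonpos g) (h : ∀ x, f x ≤ g x) : AvgNonpos f := by
  obtain ⟨C, hC⟩ := hg
  exact ⟨C, fun n => (sum_le_sum fun x _ => h x).trans (hC n)⟩

theorem avgNonpos_zero : AvgNonpos fun _ => 0 :=
  ⟨0, fun n => by simp⟩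

theorem AvgNonpos.add (hf : AvgNonpos f) (hg : AvgNonpos g) : AvgNonpos fun x => f x + g x := by
  obtain ⟨C, hC⟩ := hf
  obtain ⟨D, hD⟩ := hg
  refine ⟨C + D, fun n => ?_⟩
  rw [sum_add_distrib, add_mul]
  exact add_le_add (hC n) (hD n)

theorem AvgNonpos.const_mul (hf : AvgNonpos f) {c : ℝ} (hc : 0 ≤ c) :
    AvgNonpos fun x => c * f x := by
  obtain ⟨C, hC⟩ := hf
  refine ⟨c * C, fun n => ?_⟩
  rw [← mul_sum, mul_assoc]
  exact mul_le_mul_of_nonneg_left (hC n) hc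

theorem AvgNonpos.sum {ι : Type*} (s : Finset ι) {f : ι → ℤ × ℤ → ℝ}
    (h : ∀ i ∈ s, AvgNonpos (f i)) : AvgNonpos fun x => ∑ i ∈ s, f i x := by
  classical
  induction s using Finset.induction_on with
  | empty => simpa using avgNonpos_zero
  | insert a s ha ih =>
    simp only [sum_insert ha]
    exact (h a (mem_insert_self _ _)).add (ih fun i hi => h i (mem_insert_of_mem hi))

theorem boxFinset_sdiff_map_add_subset_boxRim (n : ℕ) (v : ℤ × ℤ) :
    boxFinset n \ (boxFinset n).map (addRightEmbedding v) ⊆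
      boxRim n (max v.1.natAbs v.2.natAbs) := by
  intro x hx
  obtain ⟨hxn, hxv⟩ := mem_sdiff.1 hx
  refine mem_filter.2 ⟨hxn, ?_⟩
  have hsub : x - v ∉ boxFinset n := fun h =>
    hxv (mem_map.2 ⟨x - v, h, sub_add_cancel x v⟩)
  by_contra! hcon
  refine hsub (mem_boxFinset.2 ?_)
  have h1 := abs_sub x.1 v.1
  have h2 := abs_sub x.2 v.2
  have h3 := Int.abs_eq_natAbs v.1
  have h4 := Int.abs_eq_natAbs v.2
  simp only [Prod.fst_sub, Prod.snd_sub]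
  lia

theorem sum_le_card_mul {ι : Type*} (s : Finset ι) {f : ι → ℝ} {B : ℝ} (hB : ∀ x ∈ s, f x ≤ B) :
    ∑ x ∈ s, f x ≤ #s * B := by
  rw [← nsmul_eq_mul]
  exact sum_le_card_nsmul _ _ _ hB

theorem avgNonpos_shift_sub {B : ℝ} (hB : ∀ x, |f x| ≤ B) (v : ℤ × ℤ) :
    AvgNonpos fun x => f (x + v) - f x := by
  classical
  set k := max v.1.natAbs v.2.natAbs
  refine ⟨2 * (8 * k) * B, fun n => ?_⟩
  set S := boxFinset n
  set T := S.map (addRightEmbedding v)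
  have hcard : (#(S \ T) : ℝ) ≤ 8 * k * (n + 1) :=
    le_trans (mod_cast card_le_card (boxFinset_sdiff_map_add_subset_boxRim n v))
      (card_boxRim_le n k)
  calc ∑ x ∈ S, (f (x + v) - f x) = ∑ x ∈ T, f x - ∑ x ∈ S, f x := by
        rw [sum_sub_distrib, sum_map]; rfl
    _ = ∑ x ∈ T \ S, f x + ∑ x ∈ S \ T, -f x := by
        rw [← sum_sdiff_sub_sum_sdiff, sum_neg_distrib, sub_eq_add_neg]
    _ ≤ #(T \ S) * B + #(S \ T) * B :=
        add_le_add (sum_le_card_mul _ fun x _ => (le_abs_self _).trans (hB x))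
          (sum_le_card_mul _ fun x _ => (neg_le_abs _).trans (hB x))
    _ = 2 * #(S \ T) * B := by rw [card_sdiff_comm (card_map _)]; ring
    _ ≤ 2 * (8 * k) * B * (n + 1) := by
        have := mul_le_mul_of_nonneg_right hcard ((abs_nonneg _).trans (hB 0))
        linarith

theorem avgNonpos_sub_shift {B : ℝ} (hB : ∀ x, |f x| ≤ B) (v : ℤ × ℤ) :
    AvgNonpos fun x => f x - f (x + v) :=
  (avgNonpos_shift_sub (f := fun x => -f x) (fun x => by simpa using hB x) v).mono
    fun x => by linarith

end BoxAverages

section Density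

variable {W : Set (ℤ × ℤ)} {ρ : ℝ}

/-- The real-valued indicator function of a set. -/
noncomputable abbrev ind {α : Type*} (s : Set α) : α → ℝ := s.indicator 1

theorem ind_of_mem {α : Type*} {s : Set α} {x : α} (h : x ∈ s) : ind s x = 1 :=
  Set.indicator_of_mem h 1

theorem ind_of_notMem {α : Type*} {s : Set α} {x : α} (h : x ∉ s) : ind s x = 0 :=
  Set.indicator_of_notMem h 1

theorem ind_nonneg {α : Type*} (s : Set α) (x : α) : 0 ≤ ind s x :=
  Set.indicator_nonneg (fun _ _ => zero_le_one) x

theorem ind_le_one {α : Type*} (s : Set α) (x : α) : ind s x ≤ 1 :=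
  Set.indicator_le_self' (fun _ _ => zero_le_one) x

theorem abs_ind_le_one {α : Type*} (s : Set α) (x : α) : |ind s x| ≤ 1 :=
  abs_le.2 ⟨by linarith [ind_nonneg s x], ind_le_one s x⟩

theorem sum_boxFinset_ind (W : Set (ℤ × ℤ)) (n : ℕ) :
    ∑ x ∈ boxFinset n, ind W x = (W ∩ box n).ncard := by
  classical
  have hW : W ∩ box n = ({x ∈ boxFinset n | x ∈ W} : Finset _) := by
    ext x
    simp [← coe_boxFinset, and_comm]
  rw [hW, Set.ncard_coe_finset]
  simp [Set.indicator_apply]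

theorem tendsto_add_mul_div_side_sq (ρ C : ℝ) :
    Tendsto (fun n : ℕ => ρ + C * ((n : ℝ) + 1) / (2 * (n : ℝ) + 1) ^ 2) atTop (𝓝 ρ) := by
  have hbound : Tendsto (fun n : ℕ => |C| * ((1 : ℝ) / ((n : ℝ) + 1))) atTop (𝓝 0) := by
    simpa using tendsto_one_div_add_atTop_nhds_zero_nat.const_mul |C|
  suffices Tendsto (fun n : ℕ => C * ((n : ℝ) + 1) / (2 * (n : ℝ) + 1) ^ 2) atTop (𝓝 0) by
    simpa using this.const_add ρ
  refine squeeze_zero_norm (fun n => ?_) hbound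
  rw [Real.norm_eq_abs, abs_div, abs_mul, abs_of_nonneg (by positivity : (0 : ℝ) ≤ n + 1),
    abs_of_nonneg (by positivity : (0 : ℝ) ≤ (2 * (n : ℝ) + 1) ^ 2), mul_div_assoc]
  refine mul_le_mul_of_nonneg_left ?_ (abs_nonneg C)
  rw [div_le_div_iff₀ (by positivity) (by positivity)]
  nlinarith

theorem ncard_inter_box_div_le_one (W : Set (ℤ × ℤ)) (n : ℕ) :
    ((W ∩ box n).ncard : ℝ) / (2 * (n : ℝ) + 1) ^ 2 ≤ 1 := by
  rw [div_le_one (by positivity), ← sum_boxFinset_ind]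
  calc ∑ x ∈ boxFinset n, ind W x ≤ #(boxFinset n) * 1 :=
        sum_le_card_mul _ fun x _ => ind_le_one W x
    _ = (2 * (n : ℝ) + 1) ^ 2 := by rw [card_boxFinset]; simp

theorem density_le_of_avgNonpos (h : AvgNonpos fun x => ind W x - ρ) : density W ≤ ρ := by
  obtain ⟨C, hC⟩ := h
  rw [density, ← (tendsto_add_mul_div_side_sq ρ C).liminf_eq]
  refine liminf_le_liminf (Eventually.of_forall fun n => ?_)
    (isBoundedUnder_of ⟨0, fun n => by positivity⟩)
    (tendsto_add_mul_div_side_sq ρ C).isCoboundedUnder_ge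
  have hn := hC n
  rw [sum_sub_distrib, sum_boxFinset_ind, sum_const, card_boxFinset, nsmul_eq_mul] at hn
  push_cast at hn
  have hp : (0 : ℝ) < (2 * (n : ℝ) + 1) ^ 2 := by positivity
  rw [div_le_iff₀ hp, add_mul, div_mul_cancel₀ _ hp.ne']
  linarith

theorem le_density_of_avgNonpos (h : AvgNonpos fun x => ρ - ind W x) : ρ ≤ density W := by
  obtain ⟨C, hC⟩ := h
  rw [density, ← (tendsto_add_mul_div_side_sq ρ (-C)).liminf_eq]
  refine liminf_le_liminf (Eventually.of_forall fun n => ?_)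
    (tendsto_add_mul_div_side_sq ρ (-C)).isBoundedUnder_ge
    (isBoundedUnder_of ⟨1, ncard_inter_box_div_le_one W⟩).isCoboundedUnder_ge
  have hn := hC n
  rw [sum_sub_distrib, sum_boxFinset_ind, sum_const, card_boxFinset, nsmul_eq_mul] at hn
  push_cast at hn
  have hp : (0 : ℝ) < (2 * (n : ℝ) + 1) ^ 2 := by positivity
  rw [le_div_iff₀ hp, add_mul, div_mul_cancel₀ _ hp.ne']
  linarith

end Density

section Components

/-! ### Connected components of bounded size -/

variable {V : Type*} {G : SimpleGraph V} {W : Set V} {k : ℕ} {x y z : V}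

/-- Every connected component of the subgraph of `G` induced on `W` has at most `k` vertices. -/
def ComponentsCardLE (G : SimpleGraph V) (W : Set V) (k : ℕ) : Prop :=
  ∀ c : (G.induce W).ConnectedComponent, c.supp.encard ≤ k

theorem maxCC_le_iff {G : SimpleGraph (ℤ × ℤ)} {W : Set (ℤ × ℤ)} {k : ℕ} :
    maxCC G W ≤ k ↔ ComponentsCardLE G W k :=
  iSup_le_iff

open Classical in
/-- The vertices of the component of `x` in the subgraph of `G` induced on `W`. This is empty when
`x ∉ W`, and also (as a junk value) when the component is infinite. -/
noncomputable def comp (G : SimpleGraph V) (W : Set V) (x : V) : Finset V :=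
  if h : {y | ∃ hx hy, (G.induce W).Reachable ⟨x, hx⟩ ⟨y, hy⟩}.Finite then h.toFinset else ∅

namespace ComponentsCardLE

theorem encard_reachable_le (hW : ComponentsCardLE G W k) (x : V) :
    {y | ∃ hx hy, (G.induce W).Reachable ⟨x, hx⟩ ⟨y, hy⟩}.encard ≤ k := by
  by_cases hx : x ∈ W
  · refine le_trans (Set.encard_le_encard ?_)
      ((Set.encard_image_le Subtype.val _).trans (hW ((G.induce W).connectedComponentMk ⟨x, hx⟩)))
    rintro y ⟨hx, hy, hxy⟩
    exact ⟨⟨y, hy⟩, SimpleGraph.ConnectedComponent.sound hxy.symm, rfl⟩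
  · simp [hx]

theorem mem_comp_iff (hW : ComponentsCardLE G W k) :
    y ∈ comp G W x ↔ ∃ hx hy, (G.induce W).Reachable ⟨x, hx⟩ ⟨y, hy⟩ := by
  rw [comp, dif_pos (Set.finite_of_encard_le_coe (hW.encard_reachable_le x)),
    Set.Finite.mem_toFinset]
  rfl

theorem card_comp_le (hW : ComponentsCardLE G W k) (x : V) : #(comp G W x) ≤ k := by
  have hle := hW.encard_reachable_le x
  have hfin := Set.finite_of_encard_le_coe hle
  rw [hfin.encard_eq_coe_toFinset_card] at hle
  rw [comp, dif_pos hfin]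
  exact_mod_cast hle

theorem mem_comp_self (hW : ComponentsCardLE G W k) (hx : x ∈ W) : x ∈ comp G W x :=
  hW.mem_comp_iff.2 ⟨hx, hx, .refl _⟩

theorem mem_of_mem_comp (hW : ComponentsCardLE G W k) (hy : y ∈ comp G W x) : y ∈ W :=
  let ⟨_, hyW, _⟩ := hW.mem_comp_iff.1 hy
  hyW

theorem mem_of_mem_comp_left (hW : ComponentsCardLE G W k) (hy : y ∈ comp G W x) : x ∈ W :=
  let ⟨hxW, _, _⟩ := hW.mem_comp_iff.1 hy
  hxW

theorem coe_comp_subset (hW : ComponentsCardLE G W k) (x : V) : ↑(comp G W x) ⊆ W :=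
  fun _ => hW.mem_of_mem_comp

theorem card_comp_pos (hW : ComponentsCardLE G W k) (hx : x ∈ W) : 0 < #(comp G W x) :=
  card_pos.2 ⟨x, hW.mem_comp_self hx⟩

theorem comp_eq_of_mem (hW : ComponentsCardLE G W k)
    (hy : y ∈ comp G W x) : comp G W y = comp G W x := by
  obtain ⟨hx, hy, hxy⟩ := hW.mem_comp_iff.1 hy
  ext z
  rw [hW.mem_comp_iff, hW.mem_comp_iff]
  exact ⟨fun ⟨_, hz, hyz⟩ => ⟨hx, hz, hxy.trans hyz⟩,
    fun ⟨_, hz, hxz⟩ => ⟨hy, hz, hxy.symm.trans hxz⟩⟩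

theorem mem_comp_of_adj (hW : ComponentsCardLE G W k)
    (hy : y ∈ comp G W x) (hz : z ∈ W) (hyz : G.Adj y z) :
    z ∈ comp G W x := by
  obtain ⟨hx, hy, hxy⟩ := hW.mem_comp_iff.1 hy
  have hyz' : (G.induce W).Adj ⟨y, hy⟩ ⟨z, hz⟩ := hyz
  exact hW.mem_comp_iff.2 ⟨hx, hz, hxy.trans hyz'.reachable⟩

theorem comp_induction (hW : ComponentsCardLE G W k) {P : V → Prop} (hx : P x)
    (step : ∀ a ∈ comp G W x, ∀ b ∈ comp G W x, G.Adj a b → P a → P b) :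
    ∀ y ∈ comp G W x, P y := by
  intro y hy
  obtain ⟨hxW, hyW, hxy⟩ := hW.mem_comp_iff.1 hy
  suffices ∀ w : W, Relation.ReflTransGen (G.induce W).Adj ⟨x, hxW⟩ w →
      w.1 ∈ comp G W x ∧ P w from
    (this ⟨y, hyW⟩ ((SimpleGraph.reachable_iff_reflTransGen _ _).1 hxy)).2
  intro w hw
  induction hw with
  | refl => exact ⟨hW.mem_comp_self hxW, hx⟩
  | @tail b c _ hbc ih =>
    have hc : c.1 ∈ comp G W x := hW.mem_comp_of_adj ih.1 c.2 hbc
    exact ⟨hc, step b ih.1 c hc hbc ih.2⟩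

theorem exists_image_comp_eq_Icc (hW : ComponentsCardLE G W k) (hx : x ∈ W) (f : V → ℤ)
    (hf : ∀ a b, G.Adj a b → |f a - f b| ≤ 1) :
    ∃ a b : ℤ, a ≤ b ∧ (comp G W x).image f = Icc a b := by
  have hne : ((comp G W x).image f).Nonempty := ⟨f x, mem_image_of_mem f (hW.mem_comp_self hx)⟩
  refine ⟨_, _, min'_le_max' _ hne, ?_⟩
  ext t
  rw [mem_Icc]
  refine ⟨fun ht => ⟨min'_le _ _ ht, le_max' _ _ ht⟩, fun ⟨hmin, hmax⟩ => ?_⟩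
  by_contra hnot
  have hne_t : ∀ a ∈ comp G W x, f a ≠ t := fun a ha h => hnot (h ▸ mem_image_of_mem f ha)
  obtain ⟨p, hp, hpmin⟩ := mem_image.1 (min'_mem _ hne)
  obtain ⟨q, hq, hqmax⟩ := mem_image.1 (max'_mem _ hne)
  have hpt : f p < t := lt_of_le_of_ne (hpmin ▸ hmin) (hne_t p hp)
  have hpx := hW.comp_eq_of_mem hp
  rw [← hpx] at hq hne_t
  have hqt : f q < t := hW.comp_induction (P := fun z => f z < t) hpt
    (fun a _ b hb hab hat => lt_of_le_of_ne
      (by have := abs_le.1 (hf a b hab); lia) (hne_t b hb)) q hq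
  exact hqt.not_ge (hqmax ▸ hmax)

theorem abs_sub_lt (hW : ComponentsCardLE G W k) (hy : y ∈ comp G W x) (f : V → ℤ)
    (hf : ∀ a b, G.Adj a b → |f a - f b| ≤ 1) : |f y - f x| < k := by
  have hx := hW.mem_of_mem_comp_left hy
  obtain ⟨a, b, -, himage⟩ := hW.exists_image_comp_eq_Icc hx f hf
  have hfy : f y ∈ Icc a b := himage ▸ mem_image_of_mem f hy
  have hfx : f x ∈ Icc a b := himage ▸ mem_image_of_mem f (hW.mem_comp_self hx)
  have hcard : #(Icc a b) ≤ k := himage ▸ card_image_le.trans (hW.card_comp_le x)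
  rw [Int.card_Icc] at hcard
  rw [mem_Icc] at hfx hfy
  rw [abs_lt]
  lia

theorem sum_nonpos_of_comp_subset (hW : ComponentsCardLE G W k)
    {f : V → ℝ} {S : Finset V} (hSW : ↑S ⊆ W)
    (hS : ∀ x ∈ S, comp G W x ⊆ S) (hsum : ∀ x ∈ S, ∑ y ∈ comp G W x, f y ≤ 0) :
    ∑ x ∈ S, f x ≤ 0 := by
  classical
  rw [← sum_fiberwise_of_maps_to (g := comp G W) (t := S.image (comp G W))
    fun x hx => mem_image_of_mem _ hx]
  refine sum_nonpos fun c hc => ?_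
  obtain ⟨x, hx, rfl⟩ := mem_image.1 hc
  have hfiber : {y ∈ S | comp G W y = comp G W x} = comp G W x := by
    ext y
    rw [mem_filter]
    exact ⟨fun ⟨hyS, hyx⟩ => hyx ▸ hW.mem_comp_self (hSW hyS),
      fun hy => ⟨hS x hx hy, hW.comp_eq_of_mem hy⟩⟩
  rw [hfiber]
  exact hsum x hx

end ComponentsCardLE

end Components

section PixelComponents

variable {G : SimpleGraph (ℤ × ℤ)} {W : Set (ℤ × ℤ)} {k : ℕ}

theorem adj8_abs_sub_le_one {a b : ℤ × ℤ} (h : adj8.Adj a b) :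
    |a.1 - b.1| ≤ 1 ∧ |a.2 - b.2| ≤ 1 :=
  max_le_iff.1 (le_of_eq h)

theorem adj4_le_adj8 : adj4 ≤ adj8 := by
  intro a b h
  change |a.1 - b.1| + |a.2 - b.2| = 1 at h
  change max |a.1 - b.1| |a.2 - b.2| = 1
  have := abs_nonneg (a.1 - b.1)
  have := abs_nonneg (a.2 - b.2)
  lia

namespace ComponentsCardLE

theorem comp_subset_boxFinset_of_notMem_boxRim (hW : ComponentsCardLE G W k)
    (hG : G ≤ adj8) {n : ℕ} {x : ℤ × ℤ}
    (hxn : x ∈ boxFinset n) (hxk : x ∉ boxRim n k) : comp G W x ⊆ boxFinset n := by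
  intro y hy
  have hdist1 := hW.abs_sub_lt hy Prod.fst fun a b h => (adj8_abs_sub_le_one (hG h)).1
  have hdist2 := hW.abs_sub_lt hy Prod.snd fun a b h => (adj8_abs_sub_le_one (hG h)).2
  have htri1 := abs_add_le x.1 (y.1 - x.1)
  have htri2 := abs_add_le x.2 (y.2 - x.2)
  rw [add_sub_cancel] at htri1 htri2
  simp only [boxRim, mem_filter, hxn, true_and, not_or] at hxk
  rw [mem_boxFinset]
  lia

theorem avgNonpos (hW : ComponentsCardLE G W k)
    (hG : G ≤ adj8) {f : ℤ × ℤ → ℝ} {B : ℝ} (hB : ∀ x, f x ≤ B)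
    (hoff : ∀ x ∉ W, f x ≤ 0) (hsum : ∀ x ∈ W, ∑ y ∈ comp G W x, f y ≤ 0) : AvgNonpos f := by
  classical
  wlog hB0 : 0 ≤ B generalizing B
  · exact this (B := 0) (fun x => (hB x).trans (not_le.1 hB0).le) le_rfl
  refine ⟨8 * k * B, fun n => ?_⟩
  set S := boxFinset n
  set P : ℤ × ℤ → Prop := fun x => comp G W x ⊆ S
  have hinner : ∑ x ∈ S with x ∈ W ∧ P x, f x ≤ 0 := by
    refine hW.sum_nonpos_of_comp_subset (fun x hx => (mem_filter.1 hx).2.1) ?_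
      fun x hx => hsum x (mem_filter.1 hx).2.1
    intro x hx y hy
    have hxS := (mem_filter.1 hx).2.2
    exact mem_filter.2 ⟨hxS hy, hW.mem_of_mem_comp hy, (hW.comp_eq_of_mem hy).trans_subset hxS⟩
  have hrim : ∑ x ∈ S with ¬(x ∈ W ∧ P x), f x ≤ #(boxRim n k) * B := by
    rw [← nsmul_eq_mul, ← sum_const]
    refine (sum_le_sum (g := fun x => if x ∈ boxRim n k then B else 0) fun x hx => ?_).trans ?_
    · obtain ⟨hxS, hx⟩ := mem_filter.1 hx
      split_ifs with hxk
      · exact hB x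
      · exact hoff x fun hxW => hx ⟨hxW, hW.comp_subset_boxFinset_of_notMem_boxRim hG hxS hxk⟩
    · rw [← sum_filter]
      exact sum_le_sum_of_subset_of_nonneg (fun x hx => (mem_filter.1 hx).2) fun _ _ _ => hB0
  rw [← sum_filter_add_sum_filter_not S fun x => x ∈ W ∧ P x]
  have := mul_le_mul_of_nonneg_right (card_boxRim_le n k) hB0
  linarith

end ComponentsCardLE

end PixelComponents

section Blocks

/-! ### Blocks of four pixels -/

open scoped Pointwise

variable {W : Set (ℤ × ℤ)} {F : ℤ × ℤ → ℝ} {B : ℝ}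

/-- The offsets of the pixels of a `2 × 2` block from its lower left pixel. A block is represented
by its lower left pixel throughout. -/
def corners : Finset (ℤ × ℤ) := {(0, 0), (1, 0), (0, 1), (1, 1)}

theorem card_corners : #corners = 4 := rfl

open Classical in
/-- The number of pixels of `W` in the block `v`. -/
noncomputable def blockCount (W : Set (ℤ × ℤ)) (v : ℤ × ℤ) : ℕ := #{d ∈ corners | v + d ∈ W}

theorem blockCount_le_four (W : Set (ℤ × ℤ)) (v : ℤ × ℤ) : blockCount W v ≤ 4 := by
  classical exact card_filter_le _ _

theorem blockCount_pos {v d : ℤ × ℤ} (hd : d ∈ corners) (h : v + d ∈ W) : 0 < blockCount W v := by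
  classical exact card_pos.2 ⟨d, mem_filter.2 ⟨hd, h⟩⟩

theorem blockCount_le_of_imp {W' : Set (ℤ × ℤ)} {v : ℤ × ℤ}
    (h : ∀ d ∈ corners, v + d ∈ W → v + d ∈ W') : blockCount W v ≤ blockCount W' v := by
  classical
  exact card_le_card fun d hd =>
    let ⟨hdc, hdW⟩ := mem_filter.1 hd
    mem_filter.2 ⟨hdc, h d hdc hdW⟩

open Classical in
theorem blockCount_eq (W : Set (ℤ × ℤ)) (v : ℤ × ℤ) :
    blockCount W v = (if v ∈ W then 1 else 0) + (if v + (1, 0) ∈ W then 1 else 0)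
      + (if v + (0, 1) ∈ W then 1 else 0) + (if v + (1, 1) ∈ W then 1 else 0) := by
  rw [blockCount, card_filter, corners, sum_insert (by decide), sum_insert (by decide),
    sum_insert (by decide), sum_singleton, Prod.mk_zero_zero, add_zero]
  ring

theorem cast_blockCount (W : Set (ℤ × ℤ)) (v : ℤ × ℤ) :
    (blockCount W v : ℝ) = ∑ d ∈ corners, ind W (v + d) := by
  classical
  simp only [blockCount, Set.indicator_apply, Pi.one_apply, sum_boole]

/-- The blocks that contain a pixel of `C`. -/
def blocksMeeting (C : Finset (ℤ × ℤ)) : Finset (ℤ × ℤ) := C - corners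

theorem mem_sub_iff_exists_add_mem {α : Type*} [AddGroup α] [DecidableEq α] {C D : Finset α}
    {v : α} : v ∈ C - D ↔ ∃ d ∈ D, v + d ∈ C := by
  rw [Finset.mem_sub]
  constructor
  · rintro ⟨x, hx, d, hd, rfl⟩
    exact ⟨d, hd, by rwa [sub_add_cancel]⟩
  · rintro ⟨d, hd, hvd⟩
    exact ⟨v + d, hvd, d, hd, add_sub_cancel_right v d⟩

theorem mem_blocksMeeting {C : Finset (ℤ × ℤ)} {v : ℤ × ℤ} :
    v ∈ blocksMeeting C ↔ ∃ d ∈ corners, v + d ∈ C :=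
  mem_sub_iff_exists_add_mem

theorem sum_sum_corners (C : Finset (ℤ × ℤ)) (H : ℤ × ℤ → ℝ) :
    ∑ x ∈ C, ∑ d ∈ corners, H (x - d) = ∑ v ∈ blocksMeeting C, blockCount ↑C v * H v := by
  classical
  calc ∑ x ∈ C, ∑ d ∈ corners, H (x - d)
      = ∑ d ∈ corners, ∑ v ∈ blocksMeeting C, if v + d ∈ C then H v else 0 := by
        rw [sum_comm]
        refine sum_congr rfl fun d hd => ?_
        rw [← sum_filter]
        refine sum_bij' (fun x _ => x - d) (fun v _ => v + d) ?_ ?_ ?_ ?_ ?_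
        · intro x hx
          rw [mem_filter, sub_add_cancel]
          exact ⟨sub_mem_sub hx hd, hx⟩
        · exact fun v hv => (mem_filter.1 hv).2
        · exact fun x _ => sub_add_cancel x d
        · exact fun v _ => add_sub_cancel_right v d
        · exact fun _ _ => rfl
    _ = ∑ v ∈ blocksMeeting C, blockCount ↑C v * H v := by
        rw [sum_comm]
        refine sum_congr rfl fun v _ => ?_
        rw [← sum_filter, sum_const, nsmul_eq_mul]
        simp only [blockCount, mem_coe]

theorem sum_blockCount (C : Finset (ℤ × ℤ)) :
    ∑ v ∈ blocksMeeting C, (blockCount ↑C v : ℝ) = 4 * #C := by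
  have h := sum_sum_corners C fun _ => 1
  simp only [sum_const, card_corners, nsmul_eq_mul, mul_one] at h
  rw [← h]
  push_cast
  ring

/-- The function on pixels obtained by dividing the value that `F` gives to each block equally
among the pixels of `W` in it. -/
noncomputable def spread (W : Set (ℤ × ℤ)) (F : ℤ × ℤ → ℝ) (x : ℤ × ℤ) : ℝ :=
  ind W x * ∑ d ∈ corners, F (x - d) / blockCount W (x - d)

theorem abs_div_blockCount_le (hB : ∀ v, |F v| ≤ B) (v : ℤ × ℤ) : |F v / blockCount W v| ≤ B := by
  rw [abs_div, Nat.abs_cast]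
  rcases Nat.eq_zero_or_pos (blockCount W v) with h | h
  · rw [h, Nat.cast_zero, div_zero]
    exact (abs_nonneg _).trans (hB 0)
  · exact (div_le_self (abs_nonneg _) (by exact_mod_cast h)).trans (hB v)

theorem abs_spread_le (hB : ∀ v, |F v| ≤ B) (x : ℤ × ℤ) : |spread W F x| ≤ 4 * B := by
  rw [spread, abs_mul]
  calc _ ≤ 1 * ∑ d ∈ corners, |F (x - d) / blockCount W (x - d)| :=
        mul_le_mul (abs_ind_le_one W x) (abs_sum_le_sum_abs _ _) (abs_nonneg _) zero_le_one
    _ ≤ 4 * B := by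
        rw [one_mul]
        exact sum_le_card_mul corners fun d _ => abs_div_blockCount_le hB _

theorem eq_sum_ind_mul_div_blockCount (hF : ∀ v, blockCount W v = 0 → F v = 0) (v : ℤ × ℤ) :
    F v = ∑ d ∈ corners, ind W (v + d) * (F v / blockCount W v) := by
  rw [← sum_mul, ← cast_blockCount]
  rcases eq_or_ne (blockCount W v) 0 with h | h
  · rw [hF v h, zero_div, mul_zero]
  · rw [mul_div_cancel₀ _ (by exact_mod_cast h)]

theorem avgNonpos_sub_spread (hB : ∀ v, |F v| ≤ B) (hF : ∀ v, blockCount W v = 0 → F v = 0) :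
    AvgNonpos fun x => F x - spread W F x := by
  have hterm (d v : ℤ × ℤ) : |ind W (v + d) * (F v / blockCount W v)| ≤ B := by
    rw [abs_mul]
    exact (mul_le_of_le_one_left (abs_nonneg _) (abs_ind_le_one W _)).trans
      (abs_div_blockCount_le hB v)
  refine (AvgNonpos.sum corners fun d _ => avgNonpos_sub_shift (hterm d) (-d)).mono fun x => ?_
  rw [sum_sub_distrib, ← eq_sum_ind_mul_div_blockCount hF, spread, mul_sum]
  simp only [neg_add_cancel_right, sub_eq_add_neg, le_refl]

theorem sum_spread {C : Finset (ℤ × ℤ)} (hC : ↑C ⊆ W) (hF : ∀ v ∈ blocksMeeting C, F v ≠ 0 →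
      ∀ e ∈ corners, v + e ∈ W → v + e ∈ C) :
    ∑ x ∈ C, spread W F x = ∑ v ∈ blocksMeeting C, F v := by
  classical
  have hspread : ∀ x ∈ C, spread W F x = ∑ d ∈ corners, F (x - d) / blockCount W (x - d) :=
    fun x hx => by rw [spread, ind_of_mem (hC hx), one_mul]
  rw [sum_congr rfl hspread, sum_sum_corners C fun v => F v / blockCount W v]
  refine sum_congr rfl fun v hv => ?_
  rcases eq_or_ne (F v) 0 with hFv | hFv
  · rw [hFv, zero_div, mul_zero]
  obtain ⟨d, hd, hvd⟩ := mem_blocksMeeting.1 hv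
  have hcount : blockCount C v = blockCount W v :=
    (blockCount_le_of_imp fun _ _ h => hC h).antisymm (blockCount_le_of_imp (hF v hv hFv))
  rw [hcount, mul_div_cancel₀]
  exact_mod_cast (blockCount_pos hd (hC hvd)).ne'

/-- If `F` is supported on blocks whose white pixels all lie in one component, then the mean of
`F` over all blocks can be computed component by component. -/
theorem ComponentsCardLE.avgNonpos_add {G : SimpleGraph (ℤ × ℤ)} {k : ℕ}
    (hW : ComponentsCardLE G W k) (hG : G ≤ adj8) {g : ℤ × ℤ → ℝ} {D : ℝ} (hB : ∀ v, |F v| ≤ B)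
    (hF : ∀ v, blockCount W v = 0 → F v = 0)
    (hblock : ∀ x, ∀ v ∈ blocksMeeting (comp G W x), F v ≠ 0 →
      ∀ e ∈ corners, v + e ∈ W → v + e ∈ comp G W x)
    (hD : ∀ x, g x ≤ D) (hoff : ∀ x ∉ W, g x ≤ 0)
    (hsum : ∀ x ∈ W, ∑ v ∈ blocksMeeting (comp G W x), F v + ∑ y ∈ comp G W x, g y ≤ 0) :
    AvgNonpos fun x => F x + g x := by
  have hspread : AvgNonpos fun x => spread W F x + g x := by
    refine hW.avgNonpos hG (B := 4 * B + D) (fun x => ?_) (fun x hx => ?_) fun x hx => ?_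
    · exact add_le_add ((le_abs_self _).trans (abs_spread_le hB x)) (hD x)
    · rw [spread, ind_of_notMem hx, zero_mul, zero_add]
      exact hoff x hx
    · rw [sum_add_distrib, sum_spread (hW.coe_comp_subset x) (hblock x)]
      exact hsum x hx
  refine ((avgNonpos_sub_spread hB hF).add hspread).mono fun x => ?_
  linarith

end Blocks

section Isoperimetry

/-! ### Isoperimetric inequalities -/

open scoped Pointwise

theorem card_add_card_image_le_card_sub_pair {α β γ : Type*} [AddCommGroup α] [DecidableEq α]
    [DecidableEq β] [LinearOrder γ] (S : Finset α) {d e : α} {f : α → β} {g : α → γ}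
    (hf : ∀ x, f (x - (e - d)) = f x) (hg : ∀ x, g (x - (e - d)) < g x) :
    #S + #(S.image f) ≤ #(S - {d, e}) := by
  -- On each fibre of `f`, the `g`-minimal element `x` of `S` has `x - e ∉ S - {d}`.
  have hmin : ∀ t ∈ S.image f, ∃ x ∈ S, f x = t ∧ x - (e - d) ∉ S := by
    intro t ht
    obtain ⟨z, hz, hzt⟩ := mem_image.1 ht
    obtain ⟨x, hx, hmin⟩ := exists_min_image {x ∈ S | f x = t} g ⟨z, mem_filter.2 ⟨hz, hzt⟩⟩
    obtain ⟨hxS, hxt⟩ := mem_filter.1 hx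
    exact ⟨x, hxS, hxt, fun hmem =>
      (hmin _ (mem_filter.2 ⟨hmem, (hf x).trans hxt⟩)).not_gt (hg x)⟩
  choose! m hmS hmf hmnot using hmin
  have hinj : #((S.image f).image fun t => m t - e) = #(S.image f) :=
    card_image_of_injOn fun a ha b hb hab => by
      rw [← hmf a ha, ← hmf b hb, sub_left_injective hab]
  have hdisj : Disjoint (S.image fun x => x - d) ((S.image f).image fun t => m t - e) := by
    rw [disjoint_right]
    intro y hy hyS
    obtain ⟨t, ht, rfl⟩ := mem_image.1 hy
    obtain ⟨x, hx, hxt⟩ := mem_image.1 hyS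
    refine hmnot t ht ?_
    rwa [← sub_add, ← hxt, sub_add_cancel]
  rw [← card_image_of_injective S (sub_left_injective (b := d)), ← hinj,
    ← card_union_of_disjoint hdisj]
  refine card_le_card (union_subset ?_ ?_)
  · exact image_subset_iff.2 fun x hx => sub_mem_sub hx (mem_insert_self d _)
  · exact image_subset_iff.2 fun t ht =>
      sub_mem_sub (hmS t ht) (mem_insert_of_mem (mem_singleton_self e))

theorem corners_eq_add : corners = {((0 : ℤ), (0 : ℤ)), (1, 0)} + {((0 : ℤ), (0 : ℤ)), (0, 1)} := by
  decide

theorem card_add_card_images_lt_card_blocksMeeting {C : Finset (ℤ × ℤ)} (hC : C.Nonempty) :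
    #C + #(C.image Prod.fst) + #(C.image Prod.snd) < #(blocksMeeting C) := by
  let E : Finset (ℤ × ℤ) := {(0, 0), (1, 0)}
  set R := C - E
  have hrows : #C + #(C.image Prod.snd) ≤ #R :=
    card_add_card_image_le_card_sub_pair C (g := Prod.fst) (by simp) (by simp)
  have hcols : #R + #(R.image Prod.fst) ≤ #(blocksMeeting C) := by
    rw [blocksMeeting, corners_eq_add, ← sub_sub]
    exact card_add_card_image_le_card_sub_pair R (g := Prod.snd) (by simp) (by simp)
  have hproj : #(C.image Prod.fst) + 1 ≤ #(R.image Prod.fst) := by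
    have himage : R.image Prod.fst = C.image Prod.fst - E.image Prod.fst :=
      image_image₂_distrib Prod.fst_sub
    have hE : E.image Prod.fst = {0, 1} := rfl
    have hone : #((C.image Prod.fst).image fun _ => ()) = 1 := by
      rw [image_const (hC.image _), card_singleton]
    rw [himage, hE, ← hone]
    exact card_add_card_image_le_card_sub_pair _ (g := id) (by simp) (by simp)
  lia

theorem ceil_two_mul_sqrt_le_iff {x : ℝ} {s : ℕ} : ⌈2 * √x⌉ ≤ (s : ℤ) ↔ 4 * x ≤ (s : ℝ) ^ 2 := by
  rw [Int.ceil_le, Int.cast_natCast, ← le_div_iff₀' two_pos, Real.sqrt_le_left (by positivity),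
    div_pow, le_div_iff₀ (by norm_num), mul_comm x]
  norm_num

theorem ceil_two_mul_sqrt_le {x : ℝ} {p q : ℕ} (h : x ≤ p * q) :
    (⌈2 * √x⌉ : ℝ) ≤ p + q := by
  have hceil : ⌈2 * √x⌉ ≤ ((p + q : ℕ) : ℤ) := by
    rw [ceil_two_mul_sqrt_le_iff]
    push_cast
    linarith [four_mul_le_sq_add (p : ℝ) q]
  exact_mod_cast hceil

theorem card_add_ceil_add_one_le_card_blocksMeeting {C : Finset (ℤ × ℤ)} (hC : C.Nonempty) :
    #C + (⌈2 * √(#C : ℝ)⌉ : ℝ) + 1 ≤ #(blocksMeeting C) := by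
  have hprod : #C ≤ #(C.image Prod.fst) * #(C.image Prod.snd) := by
    rw [← card_product]
    exact card_le_card fun x hx => mem_product.2 ⟨mem_image_of_mem _ hx, mem_image_of_mem _ hx⟩
  have hceil := ceil_two_mul_sqrt_le (x := #C) (by exact_mod_cast hprod)
  have hblocks : (#C + #(C.image Prod.fst) + #(C.image Prod.snd) + 1 : ℝ) ≤ #(blocksMeeting C) := by
    exact_mod_cast card_add_card_images_lt_card_blocksMeeting hC
  linarith

/-- The number of pixels of `W` in excess of two in the block `v`. -/
noncomputable def excess (W : Set (ℤ × ℤ)) (v : ℤ × ℤ) : ℝ := ((blockCount W v - 2 : ℕ) : ℝ)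

/-- The number of pixels by which the block `v` falls short of having two pixels of `W`. -/
noncomputable def slack (W : Set (ℤ × ℤ)) (v : ℤ × ℤ) : ℝ := ((2 - blockCount W v : ℕ) : ℝ)

theorem excess_nonneg (W : Set (ℤ × ℤ)) (v : ℤ × ℤ) : 0 ≤ excess W v := Nat.cast_nonneg _

theorem slack_nonneg (W : Set (ℤ × ℤ)) (v : ℤ × ℤ) : 0 ≤ slack W v := Nat.cast_nonneg _

theorem abs_excess_le (W : Set (ℤ × ℤ)) (v : ℤ × ℤ) : |excess W v| ≤ 2 := by
  rw [abs_of_nonneg (excess_nonneg W v), excess]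
  have := blockCount_le_four W v
  exact_mod_cast (by lia : blockCount W v - 2 ≤ 2)

theorem abs_slack_le (W : Set (ℤ × ℤ)) (v : ℤ × ℤ) : |slack W v| ≤ 2 := by
  rw [abs_of_nonneg (slack_nonneg W v), slack]
  exact_mod_cast Nat.sub_le 2 (blockCount W v)

theorem excess_eq_zero_of_blockCount_le {W : Set (ℤ × ℤ)} {v : ℤ × ℤ} (h : blockCount W v ≤ 2) :
    excess W v = 0 := by
  rw [excess, Nat.sub_eq_zero_of_le h, Nat.cast_zero]

theorem cast_blockCount_eq_excess_sub_slack (W : Set (ℤ × ℤ)) (v : ℤ × ℤ) :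
    (blockCount W v : ℝ) = 2 + excess W v - slack W v := by
  rw [eq_sub_iff_add_eq, excess, slack]
  exact_mod_cast (by lia : blockCount W v + (2 - blockCount W v) = 2 + (blockCount W v - 2))

/-- The index of the antidiagonal through a pixel. -/
def diagSum (p : ℤ × ℤ) : ℤ := p.1 + p.2

/-- The index of the diagonal through a pixel. -/
def diagDiff (p : ℤ × ℤ) : ℤ := p.1 - p.2

open Classical in
theorem excess_add_le_blockCount (C : Finset (ℤ × ℤ)) (v : ℤ × ℤ) :
    excess C v + (if v ∈ C - {(0, 0), (1, 1)} then 1 else 0)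
      + (if v ∈ C - {(1, 0), (0, 1)} then 1 else 0) ≤ blockCount C v := by
  have h : blockCount C v - 2 + (if v ∈ C - {(0, 0), (1, 1)} then 1 else 0)
      + (if v ∈ C - {(1, 0), (0, 1)} then 1 else 0) ≤ blockCount C v := by
    simp only [blockCount_eq, mem_sub_iff_exists_add_mem, mem_insert, mem_singleton, mem_coe,
      exists_eq_or_imp, exists_eq_left, Prod.mk_zero_zero, add_zero]
    lia
  rw [excess]
  exact_mod_cast h

theorem sum_excess_add_card_images_le (C : Finset (ℤ × ℤ)) :
    ∑ v ∈ blocksMeeting C, excess C v + #(C.image diagSum) + #(C.image diagDiff) ≤ 2 * #C := by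
  classical
  have hdiag : #C + #(C.image diagDiff) ≤ #(C - {((0 : ℤ), (0 : ℤ)), (1, 1)}) :=
    card_add_card_image_le_card_sub_pair C (g := Prod.fst) (by simp [diagDiff]) (by simp)
  have hanti : #C + #(C.image diagSum) ≤ #(C - {((1 : ℤ), (0 : ℤ)), (0, 1)}) :=
    card_add_card_image_le_card_sub_pair C (g := Prod.snd) (by simp [diagSum]) (by simp)
  have hsum := sum_le_sum fun v (_ : v ∈ blocksMeeting C) => excess_add_le_blockCount C v
  rw [sum_add_distrib, sum_add_distrib, sum_blockCount, sum_ite_mem, sum_ite_mem, blocksMeeting,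
    inter_eq_right.2 (sub_subset_sub_left (by decide)),
    inter_eq_right.2 (sub_subset_sub_left (by decide)), sum_const, sum_const] at hsum
  simp only [nsmul_eq_mul, mul_one] at hsum
  have hdiag' : (#C + #(C.image diagDiff) : ℝ) ≤ #(C - {((0 : ℤ), (0 : ℤ)), (1, 1)}) := by
    exact_mod_cast hdiag
  have hanti' : (#C + #(C.image diagSum) : ℝ) ≤ #(C - {((1 : ℤ), (0 : ℤ)), (0, 1)}) := by
    exact_mod_cast hanti
  rw [blocksMeeting]
  linarith

/-- The pixels on `m` consecutive antidiagonals, from number `a` on, and on `n` consecutive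
diagonals, from number `a'` on. -/
def diagRect (a a' : ℤ) (m n : ℕ) : Set (ℤ × ℤ) :=
  {p | diagSum p ∈ Set.Ico a (a + m) ∧ diagDiff p ∈ Set.Ico a' (a' + n)}

/-- The position of `(u, w)` when the lattice points of `[0, m) × [0, n)` are numbered row by row
in alternating directions. Consecutive positions are neighbouring points, so the parity of the
position is that of `u + w`. -/
def snakeIndex (n u w : ℤ) : ℤ := u * n + if Even u then w else n - 1 - w

theorem snakeIndex_emod_two (n u w : ℤ) : snakeIndex n u w % 2 = (u + w) % 2 := by
  rw [← Int.ModEq, Int.modEq_iff_dvd, snakeIndex]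
  rcases Int.even_or_odd' u with ⟨t, rfl | rfl⟩
  · rw [if_pos (even_two_mul t)]
    exact ⟨t - t * n, by ring⟩
  · rw [if_neg (by grind)]
    exact ⟨t + w + 1 - t * n - n, by ring⟩

theorem snakeIndex_inj {n u w u' w' : ℤ} (hw : w ∈ Set.Ico 0 n) (hw' : w' ∈ Set.Ico 0 n)
    (h : snakeIndex n u w = snakeIndex n u' w') : u = u' ∧ w = w' := by
  have hdiv {u w : ℤ} (hw : w ∈ Set.Ico 0 n) : snakeIndex n u w / n = u := by
    obtain ⟨hw0, hwn⟩ := hw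
    rw [snakeIndex, add_comm, Int.add_mul_ediv_right _ _ (by lia),
      Int.ediv_eq_zero_of_lt (by split_ifs <;> lia) (by split_ifs <;> lia), zero_add]
  have hu : u = u' := by rw [← hdiv (u := u) hw, ← hdiv (u := u') hw', h]
  subst hu
  refine ⟨rfl, ?_⟩
  rw [snakeIndex, snakeIndex, add_right_inj] at h
  split_ifs at h <;> lia

theorem snakeIndex_mem_Ico {m n u w : ℤ} (hu : u ∈ Set.Ico 0 m) (hw : w ∈ Set.Ico 0 n) :
    snakeIndex n u w ∈ Set.Ico 0 (m * n) := by
  obtain ⟨hu0, hum⟩ := hu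
  obtain ⟨hw0, hwn⟩ := hw
  have hlow : 0 ≤ u * n := mul_nonneg hu0 (by lia)
  have hhigh : u * n + n ≤ m * n := by
    rw [← add_one_mul]
    exact mul_le_mul_of_nonneg_right (by lia) (by lia)
  rw [snakeIndex, Set.mem_Ico]
  split_ifs <;> lia

theorem two_mul_card_le_of_subset_diagRect {C : Finset (ℤ × ℤ)} {a a' : ℤ} {m n : ℕ}
    (h : ↑C ⊆ diagRect a a' m n) : 2 * #C ≤ m * n + 1 := by
  set s : ℤ × ℤ → ℤ := fun p => snakeIndex n (diagSum p - a) (diagDiff p - a')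
  have hrow {p : ℤ × ℤ} (hp : p ∈ C) : diagSum p - a ∈ Set.Ico 0 (m : ℤ) := by
    have := (h hp).1
    rw [Set.mem_Ico] at this ⊢
    lia
  have hcol {p : ℤ × ℤ} (hp : p ∈ C) : diagDiff p - a' ∈ Set.Ico 0 (n : ℤ) := by
    have := (h hp).2
    rw [Set.mem_Ico] at this ⊢
    lia
  have hparity (p : ℤ × ℤ) : s p % 2 = (a + a') % 2 := by
    simp only [s, snakeIndex_emod_two, diagSum, diagDiff]
    lia
  -- All the indices have the same parity, so halving them is injective.
  have hcard : #C ≤ #(Ico (0 : ℤ) ((m * n + 1) / 2)) := by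
    refine card_le_card_of_injOn (fun p => s p / 2) (fun p hp => ?_) fun p hp q hq hpq => ?_
    · have := snakeIndex_mem_Ico (hrow hp) (hcol hp)
      simp only [coe_Ico, Set.mem_Ico, s] at this ⊢
      lia
    · have hs : s p = s q := by
        have := hparity p
        have := hparity q
        simp only at hpq
        lia
      obtain ⟨hsum, hdiff⟩ := snakeIndex_inj (hcol hp) (hcol hq) hs
      simp only [diagSum, diagDiff] at hsum hdiff
      ext <;> lia
  rw [Int.card_Ico] at hcard
  zify at hcard ⊢
  lia

end Isoperimetry

section DensityBounds

/-! ### Density bounds for components of bounded size -/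

variable {G : SimpleGraph (ℤ × ℤ)} {W : Set (ℤ × ℤ)} {k : ℕ} {x v d e : ℤ × ℤ} {ρ : ℝ}

/-- The term of index `j` in `F8`: the largest density of an image whose 8-components all have `j`
pixels. -/
noncomputable def f8 (j : ℕ) : ℝ := (j : ℝ) / ((j : ℝ) + (⌈2 * √(j : ℝ)⌉ : ℝ) + 1)

/-- The term of index `j` in `F4`: an upper bound for the density of an image whose 4-components all
have `j` pixels. -/
noncomputable def f4 (j : ℕ) : ℝ := (j : ℝ) / ((j : ℝ) + (⌈2 * √(2 * (j : ℝ) - 1)⌉ : ℝ) / 2)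

theorem ceil_two_mul_sqrt_nonneg (x : ℝ) : (0 : ℝ) ≤ ⌈2 * √x⌉ := by
  exact_mod_cast Int.ceil_nonneg (by positivity : 0 ≤ 2 * √x)

theorem f8_le_iff {j : ℕ} : f8 j ≤ ρ ↔ (j : ℝ) ≤ ρ * (j + ⌈2 * √(j : ℝ)⌉ + 1) :=
  div_le_iff₀ (by have := ceil_two_mul_sqrt_nonneg j; positivity)

theorem f4_le_iff {j : ℕ} (hj : 0 < j) :
    f4 j ≤ ρ ↔ (j : ℝ) ≤ ρ * (j + ⌈2 * √(2 * (j : ℝ) - 1)⌉ / 2) :=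
  div_le_iff₀ (by have := ceil_two_mul_sqrt_nonneg (2 * j - 1); positivity)

theorem sum_comp_ind (hW : ComponentsCardLE G W k) (x : ℤ × ℤ) :
    ∑ y ∈ comp G W x, ind W y = #(comp G W x) := by
  rw [sum_congr rfl fun y hy => ind_of_mem (hW.mem_of_mem_comp hy), sum_const, nsmul_one]

theorem eq_or_adj8_of_mem_corners (hd : d ∈ corners) (he : e ∈ corners) :
    v + d = v + e ∨ adj8.Adj (v + d) (v + e) := by
  have hcorners : ∀ d ∈ corners, ∀ e ∈ corners, d = e ∨ max |d.1 - e.1| |d.2 - e.2| = 1 := by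
    decide
  refine (hcorners d hd e he).imp (congrArg (v + ·)) fun h => ?_
  change max |(v + d).1 - (v + e).1| |(v + d).2 - (v + e).2| = 1
  simpa only [Prod.fst_add, Prod.snd_add, add_sub_add_left_eq_sub] using h

theorem density_le_of_f8_le (hW : ComponentsCardLE adj8 W k) (hρ0 : 0 ≤ ρ)
    (hρ : ∀ j, 1 ≤ j → j ≤ k → f8 j ≤ ρ) : density W ≤ ρ := by
  classical
  set F : ℤ × ℤ → ℝ := fun v => if blockCount W v = 0 then 0 else -ρ with hF
  have hFρ (v : ℤ × ℤ) : -ρ ≤ F v ∧ |F v| ≤ ρ := by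
    simp only [hF]
    split_ifs <;> simp [hρ0, abs_of_nonneg]
  suffices h : AvgNonpos fun x => F x + ind W x from
    density_le_of_avgNonpos (h.mono fun x => by linarith [(hFρ x).1])
  refine hW.avgNonpos_add le_rfl (fun v => (hFρ v).2) (fun v hv => if_pos hv) ?_
    (ind_le_one W) (fun x hx => (ind_of_notMem hx).le) fun x hx => ?_
  · intro x v hv _ e he hve
    obtain ⟨d, hd, hvd⟩ := mem_blocksMeeting.1 hv
    rcases eq_or_adj8_of_mem_corners hd he with h | h
    · rwa [← h]
    · exact hW.mem_comp_of_adj hvd hve h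
  · set C := comp adj8 W x
    have hsum : ∑ v ∈ blocksMeeting C, F v = -(ρ * #(blocksMeeting C)) := by
      rw [sum_congr rfl (g := fun _ => -ρ), sum_const, nsmul_eq_mul, mul_neg, mul_comm]
      intro v hv
      obtain ⟨d, hd, hvd⟩ := mem_blocksMeeting.1 hv
      exact if_neg (blockCount_pos hd (hW.mem_of_mem_comp hvd)).ne'
    have hiso := mul_le_mul_of_nonneg_left
      (card_add_ceil_add_one_le_card_blocksMeeting ⟨x, hW.mem_comp_self hx⟩) hρ0
    have hf8 := f8_le_iff.1 (hρ #C (hW.card_comp_pos hx) (hW.card_comp_le x))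
    rw [hsum, sum_comp_ind hW]
    linarith

theorem avgNonpos_ind_sub_excess_add_slack (W : Set (ℤ × ℤ)) :
    AvgNonpos fun x => 4 * ind W x - 2 - excess W x + slack W x := by
  refine (AvgNonpos.sum corners fun d _ => avgNonpos_sub_shift (abs_ind_le_one W) d).mono
    fun x => ?_
  rw [sum_sub_distrib, ← cast_blockCount, cast_blockCount_eq_excess_sub_slack, sum_const,
    card_corners, nsmul_eq_mul]
  push_cast
  linarith

theorem adj4_add_iff : adj4.Adj (v + d) (v + e) ↔ |d.1 - e.1| + |d.2 - e.2| = 1 := by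
  change |(v + d).1 - (v + e).1| + |(v + d).2 - (v + e).2| = 1 ↔ _
  simp only [Prod.fst_add, Prod.snd_add, add_sub_add_left_eq_sub]

theorem adj4_path_of_excess_ne_zero (hv : excess W v ≠ 0) (hd : d ∈ corners) (he : e ∈ corners) :
    v + d = v + e ∨ adj4.Adj (v + d) (v + e) ∨
      ∃ f, v + f ∈ W ∧ adj4.Adj (v + d) (v + f) ∧ adj4.Adj (v + f) (v + e) := by
  classical
  simp only [adj4_add_iff]
  have hcorners : ∀ d ∈ corners, ∀ e ∈ corners, d = e ∨ |d.1 - e.1| + |d.2 - e.2| = 1 ∨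
      (∀ f ∈ corners, f ∉ ({d, e} : Finset (ℤ × ℤ)) →
        |d.1 - f.1| + |d.2 - f.2| = 1 ∧ |f.1 - e.1| + |f.2 - e.2| = 1) := by decide
  refine (hcorners d hd e he).imp (congrArg (v + ·)) (Or.imp_right fun hopposite => ?_)
  have hcount : #{d, e} < #{f ∈ corners | v + f ∈ W} :=
    card_le_two.trans_lt (not_le.1 fun h => hv (excess_eq_zero_of_blockCount_le h))
  obtain ⟨f, hf, hfde⟩ := exists_mem_notMem_of_card_lt_card hcount
  obtain ⟨hf, hfW⟩ := mem_filter.1 hf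
  exact ⟨f, hfW, hopposite f hf hfde⟩

theorem diagSum_abs_sub_le_one (a b : ℤ × ℤ) (h : adj4.Adj a b) :
    |diagSum a - diagSum b| ≤ 1 := by
  have h : |a.1 - b.1| + |a.2 - b.2| = 1 := h
  grind [diagSum]

theorem diagDiff_abs_sub_le_one (a b : ℤ × ℤ) (h : adj4.Adj a b) :
    |diagDiff a - diagDiff b| ≤ 1 := by
  have h : |a.1 - b.1| + |a.2 - b.2| = 1 := h
  grind [diagDiff]

namespace ComponentsCardLE

theorem mem_comp_of_excess_ne_zero (hW : ComponentsCardLE adj4 W k)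
    (hv : v ∈ blocksMeeting (comp adj4 W x)) (hexc : excess W v ≠ 0) (he : e ∈ corners)
    (hve : v + e ∈ W) : v + e ∈ comp adj4 W x := by
  obtain ⟨d, hd, hvd⟩ := mem_blocksMeeting.1 hv
  rcases adj4_path_of_excess_ne_zero hexc hd he with h | h | ⟨f, hf, hdf, hfe⟩
  · rwa [← h]
  · exact hW.mem_comp_of_adj hvd hve h
  · exact hW.mem_comp_of_adj (hW.mem_comp_of_adj hvd hf hdf) hve hfe

theorem excess_le_excess_comp (hW : ComponentsCardLE adj4 W k)
    (hv : v ∈ blocksMeeting (comp adj4 W x)) : excess W v ≤ excess (comp adj4 W x) v := by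
  rcases eq_or_ne (excess W v) 0 with h0 | h0
  · rw [h0]
    exact excess_nonneg _ _
  · have hcount : blockCount W v ≤ blockCount (comp adj4 W x) v :=
      blockCount_le_of_imp fun _ => hW.mem_comp_of_excess_ne_zero hv h0
    rw [excess, excess]
    exact_mod_cast Nat.sub_le_sub_right hcount 2

theorem exists_comp_subset_diagRect (hW : ComponentsCardLE adj4 W k) (hx : x ∈ W) :
    ∃ (a a' : ℤ) (m n : ℕ), 1 ≤ m ∧ 1 ≤ n ∧ ↑(comp adj4 W x) ⊆ diagRect a a' m n ∧
      ∑ v ∈ blocksMeeting (comp adj4 W x), excess W v + m + n ≤ 2 * #(comp adj4 W x) := by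
  obtain ⟨a, b, hab, hsum⟩ := hW.exists_image_comp_eq_Icc hx diagSum diagSum_abs_sub_le_one
  obtain ⟨a', b', hab', hdiff⟩ := hW.exists_image_comp_eq_Icc hx diagDiff diagDiff_abs_sub_le_one
  refine ⟨a, a', (b + 1 - a).toNat, (b' + 1 - a').toNat, by lia, by lia, fun p hp => ?_, ?_⟩
  · have hpsum : diagSum p ∈ Icc a b := hsum ▸ mem_image_of_mem _ hp
    have hpdiff : diagDiff p ∈ Icc a' b' := hdiff ▸ mem_image_of_mem _ hp
    rw [mem_Icc] at hpsum hpdiff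
    simp only [diagRect, Set.mem_Ico, Set.mem_ofPred_eq]
    lia
  · have himages := sum_excess_add_card_images_le (comp adj4 W x)
    have hexc := sum_le_sum fun v (hv : v ∈ blocksMeeting (comp adj4 W x)) =>
      hW.excess_le_excess_comp hv
    rw [hsum, hdiff, Int.card_Icc, Int.card_Icc] at himages
    linarith

theorem sum_excess_add_ceil_le (hW : ComponentsCardLE adj4 W k) (hx : x ∈ W) :
    ∑ v ∈ blocksMeeting (comp adj4 W x), excess W v + ⌈2 * √(2 * (#(comp adj4 W x) : ℝ) - 1)⌉ ≤
      2 * #(comp adj4 W x) := by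
  obtain ⟨a, a', m, n, -, -, hrect, hexc⟩ := hW.exists_comp_subset_diagRect hx
  have hcard : 2 * (#(comp adj4 W x) : ℝ) ≤ m * n + 1 := by
    exact_mod_cast two_mul_card_le_of_subset_diagRect hrect
  have hceil := ceil_two_mul_sqrt_le (sub_le_iff_le_add.2 hcard)
  linarith

end ComponentsCardLE

theorem density_le_of_f4_le (hW : ComponentsCardLE adj4 W k) (hρ0 : 0 < ρ)
    (hρ : ∀ j, 1 ≤ j → j ≤ k → f4 j ≤ ρ) : density W ≤ ρ := by
  set c := 2 / ρ - 4
  have hcomp : AvgNonpos fun x => excess W x + c * ind W x := by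
    refine hW.avgNonpos_add adj4_le_adj8 (D := |c|) (abs_excess_le W)
      (fun v hv => excess_eq_zero_of_blockCount_le (by lia))
      (fun x v hv hexc e => hW.mem_comp_of_excess_ne_zero hv hexc) (fun x => ?_) (fun x hx => ?_)
      fun x hx => ?_
    · refine (le_abs_self _).trans ?_
      rw [abs_mul]
      exact mul_le_of_le_one_right (abs_nonneg _) (abs_ind_le_one W x)
    · rw [ind_of_notMem hx, mul_zero]
    · rw [← mul_sum, sum_comp_ind hW]
      have hf4 := (f4_le_iff (hW.card_comp_pos hx)).1
        (hρ _ (hW.card_comp_pos hx) (hW.card_comp_le x))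
      rw [← div_le_iff₀' hρ0] at hf4
      have hiso := hW.sum_excess_add_ceil_le hx
      linear_combination hiso + 2 * hf4
  refine density_le_of_avgNonpos <| (((avgNonpos_ind_sub_excess_add_slack W).add hcomp).const_mul
    (by positivity : 0 ≤ ρ / 2)).mono fun x => ?_
  have hc : ρ / 2 * (4 + c) = 1 := by
    simp only [c]
    field_simp
    ring
  have hslack := mul_nonneg hρ0.le (slack_nonneg W x)
  linear_combination hslack / 2 - ind W x * hc

end DensityBounds

section LocalStructure

/-! ### Local structure around small 4-components -/

variable {W : Set (ℤ × ℤ)} {k : ℕ} {p q c d e f s x : ℤ × ℤ}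

/-- A duplicate-free list of pixels in which every pixel but the last is 4-adjacent to a later one,
so that its pixels are 4-connected. -/
def IsChain4 : List (ℤ × ℤ) → Prop
  | [] => True
  | d :: l => (l = [] ∨ ∃ e ∈ l, |d.1 - e.1| + |d.2 - e.2| = 1) ∧ d ∉ l ∧ IsChain4 l

instance decidableIsChain4 : (l : List (ℤ × ℤ)) → Decidable (IsChain4 l)
  | [] => isTrue trivial
  | d :: l =>
    have := decidableIsChain4 l
    inferInstanceAs (Decidable ((l = [] ∨ ∃ e ∈ l, |d.1 - e.1| + |d.2 - e.2| = 1) ∧ d ∉ l ∧ _))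

theorem IsChain4.nodup : ∀ {l : List (ℤ × ℤ)}, IsChain4 l → l.Nodup
  | [], _ => List.nodup_nil
  | _ :: _, h => List.nodup_cons.2 ⟨h.2.1, h.2.2.nodup⟩

namespace ComponentsCardLE

theorem exists_comp_of_isChain4 (hW : ComponentsCardLE adj4 W k) (p : ℤ × ℤ) :
    ∀ l : List (ℤ × ℤ), IsChain4 l → (∀ d ∈ l, p + d ∈ W) →
      ∃ x, ∀ d ∈ l, p + d ∈ comp adj4 W x
  | [], _, _ => ⟨p, by simp⟩
  | d :: l, h, hl => by
    obtain ⟨hd, hl⟩ := List.forall_mem_cons.1 hl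
    obtain ⟨x, hx⟩ := hW.exists_comp_of_isChain4 p l h.2.2 hl
    rcases h.1 with rfl | ⟨e, he, hde⟩
    · exact ⟨p + d, by simpa using hW.mem_comp_self hd⟩
    · exact ⟨x, List.forall_mem_cons.2
        ⟨hW.mem_comp_of_adj (hx e he) hd (adj4_add_iff.2 hde).symm, hx⟩⟩

theorem not_forall_mem_of_isChain4 (hW : ComponentsCardLE adj4 W k) (p : ℤ × ℤ)
    {l : List (ℤ × ℤ)} (hl : IsChain4 l) (hk : k < l.length) : ¬∀ d ∈ l, p + d ∈ W := by
  intro h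
  obtain ⟨x, hx⟩ := hW.exists_comp_of_isChain4 p l hl h
  have hsub : l.toFinset.image (p + ·) ⊆ comp adj4 W x := by
    rw [Finset.image_subset_iff]
    exact fun d hd => hx d (List.mem_toFinset.1 hd)
  have hcard := card_le_card hsub
  rw [card_image_of_injective _ (add_right_injective p),
    List.toFinset_card_of_nodup hl.nodup] at hcard
  exact (hcard.trans (hW.card_comp_le x)).not_gt hk

theorem notMem_of_isChain4 (hW : ComponentsCardLE adj4 W k) {l : List (ℤ × ℤ)}
    (hl : ∀ e ∈ l, p + e ∈ W) (hchain : IsChain4 (d :: l)) (hk : k ≤ l.length) : p + d ∉ W :=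
  fun hd => hW.not_forall_mem_of_isChain4 p hchain (by simpa [Nat.lt_succ_iff] using hk)
    (List.forall_mem_cons.2 ⟨hd, hl⟩)

end ComponentsCardLE

theorem one_le_slack (h : blockCount W p < 2) : 1 ≤ slack W p := by
  rw [slack]
  exact_mod_cast (by lia : 1 ≤ 2 - blockCount W p)

theorem mem_of_two_le_blockCount (h : 2 ≤ blockCount W (p + c)) (hd : p + d ∉ W) (he : p + e ∉ W)
    (hcorners : #(corners \ {d - c, e - c, f - c}) ≤ 1) : p + f ∈ W := by
  classical
  by_contra hf
  have hsub : {z ∈ corners | p + c + z ∈ W} ⊆ corners \ {d - c, e - c, f - c} := by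
    intro z hz
    obtain ⟨hz, hzW⟩ := mem_filter.1 hz
    refine mem_sdiff.2 ⟨hz, fun hmem => ?_⟩
    rcases (by simpa using hmem : z = d - c ∨ z = e - c ∨ z = f - c) with rfl | rfl | rfl <;>
      rw [add_assoc, add_sub_cancel] at hzW <;> contradiction
  have hcard : blockCount W (p + c) ≤ _ := card_le_card hsub
  lia

/-- The pixels of `W` that form a 4-component of their own. -/
def isolated (W : Set (ℤ × ℤ)) : Set (ℤ × ℤ) := {p | p ∈ W ∧ ∀ q ∈ W, ¬adj4.Adj p q}

theorem ComponentsCardLE.comp_eq_singleton (hW : ComponentsCardLE adj4 W k)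
    (hp : p ∈ isolated W) : comp adj4 W p = {p} := by
  refine Subset.antisymm (fun y hy => mem_singleton.2 ?_) (by simpa using hW.mem_comp_self hp.1)
  refine hW.comp_induction (P := fun z => z = p) rfl ?_ y hy
  rintro a - b hb hab rfl
  exact (hp.2 b (hW.mem_of_mem_comp hb) hab).elim

theorem ComponentsCardLE.sum_comp_ind_isolated_le (hW : ComponentsCardLE adj4 W k) (x : ℤ × ℤ) :
    ∑ y ∈ comp adj4 W x, ind (isolated W) y ≤ if #(comp adj4 W x) = 1 then 1 else 0 := by
  split_ifs with h
  · simpa [h] using sum_le_card_mul (comp adj4 W x) fun y _ => ind_le_one (isolated W) y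
  · refine sum_nonpos fun y hy => (ind_of_notMem fun hyW => h ?_).le
    rw [← hW.comp_eq_of_mem hy, hW.comp_eq_singleton hyW, card_singleton]

/-- The four diagonal directions. -/
def signs : Finset (ℤ × ℤ) := {1, -1} ×ˢ {1, -1}

theorem card_signs : #signs = 4 := by decide

theorem mem_signs_iff :
    s ∈ signs ↔ s = (1, 1) ∨ s = (1, -1) ∨ s = (-1, 1) ∨ s = (-1, -1) := by
  simp only [signs, mem_product, mem_insert, mem_singleton, Prod.ext_iff]
  tauto

theorem sum_signs (f : ℤ × ℤ → ℝ) :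
    ∑ s ∈ signs, f s = f (1, 1) + f (1, -1) + f (-1, 1) + f (-1, -1) := by
  simp [signs, sum_product, add_assoc]

theorem adj4_signs (hs : s ∈ signs) (h : adj4.Adj p q) :
    q = p + (s.1, 0) ∨ q = p + (-s.1, 0) ∨ q = p + (0, s.2) ∨ q = p + (0, -s.2) := by
  have h : |p.1 - q.1| + |p.2 - q.2| = 1 := h
  simp only [Prod.ext_iff, Prod.fst_add, Prod.snd_add]
  rcases mem_signs_iff.1 hs with rfl | rfl | rfl | rfl <;> grind

/-- Coordinate of the lower end of the segment joining `0` to `t = ±1`. -/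
def lo (t : ℤ) : ℤ := if t = 1 then 0 else -1

end LocalStructure

section ThreePixels

/-! ### Components of at most three pixels -/

variable {W : Set (ℤ × ℤ)} {p s x v : ℤ × ℤ}

/-- The white pixels whose horizontal and vertical neighbours in the directions `s` are white. -/
def lShapes (W : Set (ℤ × ℤ)) (s : ℤ × ℤ) : Set (ℤ × ℤ) :=
  {p | p ∈ W ∧ p + (s.1, 0) ∈ W ∧ p + (0, s.2) ∈ W}

theorem excess_le_sum_ind_lShapes (hW : ComponentsCardLE adj4 W 3) (v : ℤ × ℤ) :
    excess W v ≤ ∑ s ∈ signs, ind (lShapes W s) (v + (-lo s.1, -lo s.2)) := by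
  classical
  rcases eq_or_ne (excess W v) 0 with h0 | h0
  · rw [h0]
    exact sum_nonneg fun s _ => ind_nonneg _ _
  have hcount : ¬blockCount W v ≤ 2 := fun h => h0 (excess_eq_zero_of_blockCount_le h)
  have hfull := hW.not_forall_mem_of_isChain4 v
    (l := [(0, 1), (0, 0), (1, 0), (1, 1)]) (by decide) (by decide)
  rw [excess, sum_signs]
  rw [blockCount_eq] at hcount ⊢
  simp only [Set.indicator_apply, lShapes, lo, add_assoc, Prod.mk_add_mk, Set.mem_ofPred_eq]
  by_cases h00 : v ∈ W <;> by_cases h10 : v + (1, 0) ∈ W <;> by_cases h01 : v + (0, 1) ∈ W <;>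
    by_cases h11 : v + (1, 1) ∈ W <;> simp [h00, h10, h01, h11, Prod.mk_zero_zero] at hcount hfull ⊢

theorem mem_isolated_of_mem_lShapes (hW : ComponentsCardLE adj4 W 3) (hs : s ∈ signs)
    (hp : p ∈ lShapes W s) (hdiag : 2 ≤ blockCount W (p + (lo (-s.1), lo (-s.2))))
    (hhor : 2 ≤ blockCount W (p + (-s.1 + lo (-s.1), lo s.2)))
    (hver : 2 ≤ blockCount W (p + (lo s.1, -s.2 + lo (-s.2)))) :
    p + (-s.1, -s.2) ∈ isolated W := by
  obtain ⟨hp0, hp1, hp2⟩ := hp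
  have hblack : ∀ d ∈ [(-s.1, 0), (-s.1, s.2), (0, -s.2), (s.1, -s.2)], p + d ∉ W := fun d hd =>
    hW.notMem_of_isChain4 (l := [(s.1, 0), (0, 0), (0, s.2)])
      (by simp [hp0, hp1, hp2, Prod.mk_zero_zero])
      (by clear * - hs hd; revert d s; decide) le_rfl
  simp only [List.forall_mem_cons] at hblack
  obtain ⟨hb1, hb2, hb3, hb4, -⟩ := hblack
  have hw1 : p + (-s.1, -s.2) ∈ W := mem_of_two_le_blockCount hdiag hb1 hb3
    (by clear * - hs; revert s; decide)
  have hw2 : ∀ f ∈ [(2 * -s.1, 0), (2 * -s.1, s.2)], p + f ∈ W := fun f hf =>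
    mem_of_two_le_blockCount hhor hb1 hb2 (by clear * - hs hf; revert f s; decide)
  have hw3 : ∀ f ∈ [(0, 2 * -s.2), (s.1, 2 * -s.2)], p + f ∈ W := fun f hf =>
    mem_of_two_le_blockCount hver hb3 hb4 (by clear * - hs hf; revert f s; decide)
  have hb5 := hW.not_forall_mem_of_isChain4 p
    (l := [(-s.1, -s.2), (2 * -s.1, -s.2), (2 * -s.1, 0), (2 * -s.1, s.2)])
    (by clear * - hs; revert s; decide) (by simp)
  have hb6 := hW.not_forall_mem_of_isChain4 p
    (l := [(-s.1, -s.2), (-s.1, 2 * -s.2), (0, 2 * -s.2), (s.1, 2 * -s.2)])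
    (by clear * - hs; revert s; decide) (by simp)
  simp only [List.forall_mem_cons] at hw2 hw3 hb5 hb6
  refine ⟨hw1, fun q hq hadj => ?_⟩
  have hq' := adj4_signs hs hadj
  simp only [add_assoc, Prod.mk_add_mk, neg_add_cancel, add_zero,
    ← two_mul] at hq'
  rcases hq' with rfl | rfl | rfl | rfl <;> tauto

theorem ind_lShapes_le (hW : ComponentsCardLE adj4 W 3) (hs : s ∈ signs) (p : ℤ × ℤ) :
    ind (lShapes W s) p ≤ ind (isolated W) (p + (-s.1, -s.2)) +
      slack W (p + (lo (-s.1), lo (-s.2))) + slack W (p + (-s.1 + lo (-s.1), lo s.2)) +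
      slack W (p + (lo s.1, -s.2 + lo (-s.2))) := by
  have hisolated := ind_nonneg (isolated W) (p + (-s.1, -s.2))
  have hdiag := slack_nonneg W (p + (lo (-s.1), lo (-s.2)))
  have hhor := slack_nonneg W (p + (-s.1 + lo (-s.1), lo s.2))
  have hver := slack_nonneg W (p + (lo s.1, -s.2 + lo (-s.2)))
  by_cases hp : p ∈ lShapes W s
  · rw [ind_of_mem hp]
    by_contra! hlt
    refine hlt.not_ge ?_
    rw [ind_of_mem (mem_isolated_of_mem_lShapes hW hs hp ?_ ?_ ?_)]
    · linarith
    all_goals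
      by_contra! hcount
      linarith [one_le_slack hcount]
  · rw [ind_of_notMem hp]
    positivity

theorem avgNonpos_excess_sub_isolated (hW : ComponentsCardLE adj4 W 3) :
    AvgNonpos fun x => excess W x - 4 * ind (isolated W) x - 12 * slack W x := by
  have hexcess : AvgNonpos fun x => excess W x - ∑ s ∈ signs, ind (lShapes W s) x := by
    refine (AvgNonpos.sum signs fun s _ => avgNonpos_shift_sub (abs_ind_le_one (lShapes W s))
      (-lo s.1, -lo s.2)).mono fun x => ?_
    rw [sum_sub_distrib]
    linarith [excess_le_sum_ind_lShapes hW x]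
  have hlShapes (s) (hs : s ∈ signs) :
      AvgNonpos fun x => ind (lShapes W s) x - ind (isolated W) x - 3 * slack W x := by
    refine ((((avgNonpos_shift_sub (abs_ind_le_one (isolated W)) (-s.1, -s.2)).add
      (avgNonpos_shift_sub (abs_slack_le W) (lo (-s.1), lo (-s.2)))).add
      (avgNonpos_shift_sub (abs_slack_le W) (-s.1 + lo (-s.1), lo s.2))).add
      (avgNonpos_shift_sub (abs_slack_le W) (lo s.1, -s.2 + lo (-s.2)))).mono fun x => ?_
    linarith [ind_lShapes_le hW hs x]
  refine (hexcess.add (AvgNonpos.sum signs hlShapes)).mono fun x => ?_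
  simp only [sum_sub_distrib, sum_const, card_signs, nsmul_eq_mul]
  push_cast
  linarith

theorem five_mul_add_ite_le_three_mul_add {j m n : ℕ} (hm : 1 ≤ m) (hn : 1 ≤ n)
    (hj3 : j ≤ 3) (h : 2 * j ≤ m * n + 1) : 5 * j + (if j = 1 then 1 else 0) ≤ 3 * (m + n) := by
  by_contra! hlt
  have hmn : m + n ≤ 4 := by split_ifs at hlt <;> lia
  have hm4 : m ≤ 3 := by lia
  interval_cases m <;> interval_cases j <;> simp at hlt <;> lia

theorem avgNonpos_excess_add_isolated (hW : ComponentsCardLE adj4 W 3) :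
    AvgNonpos fun x => 3 * excess W x + (ind (isolated W) x - ind W x) := by
  refine hW.avgNonpos_add adj4_le_adj8 (F := fun v => 3 * excess W v) (B := 6) (D := 1)
    (fun v => ?_) (fun v hv => ?_) (fun x v hv hexc e he => ?_) (fun x => ?_) (fun x hx => ?_)
    fun x hx => ?_
  · rw [abs_mul, abs_of_pos three_pos]
    linarith [abs_excess_le W v]
  · rw [excess_eq_zero_of_blockCount_le (by lia), mul_zero]
  · exact hW.mem_comp_of_excess_ne_zero hv (right_ne_zero_of_mul hexc) he
  · linarith [ind_le_one (isolated W) x, ind_nonneg W x]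
  · rw [ind_of_notMem hx, ind_of_notMem fun h => hx h.1, sub_zero]
  · obtain ⟨a, a', m, n, hm, hn, hrect, hexc⟩ := hW.exists_comp_subset_diagRect hx
    have hmn := five_mul_add_ite_le_three_mul_add hm hn (hW.card_comp_le x)
      (two_mul_card_le_of_subset_diagRect hrect)
    have hmn : 5 * (#(comp adj4 W x) : ℝ) + (if #(comp adj4 W x) = 1 then 1 else 0) ≤
      3 * (m + n) := by exact_mod_cast hmn
    rw [← mul_sum, sum_sub_distrib, sum_comp_ind hW]
    linarith [hW.sum_comp_ind_isolated_le x]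

theorem density_le_of_components_card_le_three (hW : ComponentsCardLE adj4 W 3) :
    density W ≤ 13 / 24 := by
  refine density_le_of_avgNonpos (((((avgNonpos_ind_sub_excess_add_slack W).const_mul
    (by norm_num : (0 : ℝ) ≤ 13 / 48)).add ((avgNonpos_excess_sub_isolated hW).const_mul
    (by norm_num : (0 : ℝ) ≤ 1 / 48))).add ((avgNonpos_excess_add_isolated hW).const_mul
    (by norm_num : (0 : ℝ) ≤ 4 / 48))).mono fun x => ?_)
  linarith [slack_nonneg W x]

end ThreePixels

section SixPixels

/-! ### Components of at most six pixels -/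

variable {W : Set (ℤ × ℤ)} {k : ℕ} {c p s x v : ℤ × ℤ} {a a' : ℤ} {m n : ℕ}

/-- The centres of white pluses whose diagonal neighbour in direction `s` is white as well. -/
def plusCorners (W : Set (ℤ × ℤ)) (s : ℤ × ℤ) : Set (ℤ × ℤ) :=
  {c | ∀ d ∈ [s, (1, 0), (-1, 0), (0, 1), (0, -1), (0, 0)], c + d ∈ W}

/-- The blocks `v` containing the bend of a white hook with a vertical shaft of three pixels, whose
foot is the pixel `v + (-lo s.1, -lo (-s.2))`. -/
def verticalHooks (W : Set (ℤ × ℤ)) (s : ℤ × ℤ) : Set (ℤ × ℤ) :=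
  {v | v + (-lo s.1, -lo (-s.2)) ∈ W ∧ v + (-lo s.1 + s.1, -lo (-s.2)) ∈ W ∧
    v + (-lo s.1 + s.1, -lo (-s.2) - s.2) ∈ W ∧ v + (-lo s.1 + s.1, -lo (-s.2) - 2 * s.2) ∈ W ∧
    v + (-lo s.1, -lo (-s.2) - s.2) ∉ W ∧ v + (-lo s.1 - s.1, -lo (-s.2)) ∉ W}

/-- The blocks `v` containing the bend of a white hook with a horizontal shaft of three pixels,
whose foot is the pixel `v + (-lo (-s.1), -lo s.2)`. -/
def horizontalHooks (W : Set (ℤ × ℤ)) (s : ℤ × ℤ) : Set (ℤ × ℤ) :=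
  {v | v + (-lo (-s.1), -lo s.2) ∈ W ∧ v + (-lo (-s.1), -lo s.2 + s.2) ∈ W ∧
    v + (-lo (-s.1) - s.1, -lo s.2 + s.2) ∈ W ∧ v + (-lo (-s.1) - 2 * s.1, -lo s.2 + s.2) ∈ W ∧
    v + (-lo (-s.1) - s.1, -lo s.2) ∉ W ∧ v + (-lo (-s.1), -lo s.2 - s.2) ∉ W}

/-- The number of hooks with their bend in the block `v`. -/
noncomputable def hookCount (W : Set (ℤ × ℤ)) (v : ℤ × ℤ) : ℝ :=
  ∑ s ∈ signs, (ind (verticalHooks W s) v + ind (horizontalHooks W s) v)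

/-- The blocks whose only white pixel is the corner in direction `-s`. -/
def loneCorners (W : Set (ℤ × ℤ)) (s : ℤ × ℤ) : Set (ℤ × ℤ) :=
  {v | blockCount W v ≤ 1 ∧ v + (-lo s.1, -lo s.2) ∈ W}

/-- The blocks with at most one white pixel and none in the column on the side `-s.1`. -/
def blackColumns (W : Set (ℤ × ℤ)) (s : ℤ × ℤ) : Set (ℤ × ℤ) :=
  {v | blockCount W v ≤ 1 ∧ v + (-lo s.1, 0) ∉ W ∧ v + (-lo s.1, 1) ∉ W}

/-- The blocks with at most one white pixel and none in the row on the side `-s.2`. -/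
def blackRows (W : Set (ℤ × ℤ)) (s : ℤ × ℤ) : Set (ℤ × ℤ) :=
  {v | blockCount W v ≤ 1 ∧ v + (0, -lo s.2) ∉ W ∧ v + (1, -lo s.2) ∉ W}

theorem hookCount_nonneg (W : Set (ℤ × ℤ)) (v : ℤ × ℤ) : 0 ≤ hookCount W v :=
  sum_nonneg fun _ _ => add_nonneg (ind_nonneg _ _) (ind_nonneg _ _)

theorem hookCount_le_excess (W : Set (ℤ × ℤ)) (v : ℤ × ℤ) : hookCount W v ≤ excess W v := by
  classical
  rw [hookCount, excess, sum_signs, blockCount_eq]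
  simp only [Set.indicator_apply, verticalHooks, horizontalHooks, lo, Set.mem_ofPred_eq]
  by_cases h00 : v ∈ W <;> by_cases h10 : v + (1, 0) ∈ W <;> by_cases h01 : v + (0, 1) ∈ W <;>
    by_cases h11 : v + (1, 1) ∈ W <;> simp [h00, h10, h01, h11, Prod.mk_zero_zero] <;> grind

theorem hookCount_eq_zero_of_excess_eq_zero (h : excess W v = 0) : hookCount W v = 0 :=
  le_antisymm (h ▸ hookCount_le_excess W v) (hookCount_nonneg W v)

theorem sum_ind_lone_le_slack (W : Set (ℤ × ℤ)) (v : ℤ × ℤ) :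
    ∑ s ∈ signs, (ind (loneCorners W s) v + ind (blackColumns W s) v + ind (blackRows W s) v) ≤
      5 * slack W v := by
  classical
  rw [slack, sum_signs]
  simp only [Set.indicator_apply, loneCorners, blackColumns, blackRows, lo, Set.mem_ofPred_eq,
    blockCount_eq]
  by_cases h00 : v ∈ W <;> by_cases h10 : v + (1, 0) ∈ W <;> by_cases h01 : v + (0, 1) ∈ W <;>
    by_cases h11 : v + (1, 1) ∈ W <;> simp [h00, h10, h01, h11, Prod.mk_zero_zero] <;> norm_num

theorem notMem_of_mem_plusCorners (hW : ComponentsCardLE adj4 W 6) (hs : s ∈ signs)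
    (hc : c ∈ plusCorners W s) :
    ∀ d ∈ [(2 * s.1, 0), (2 * s.1, s.2), (0, 2 * s.2), (s.1, 2 * s.2)], c + d ∉ W :=
  fun d hd => hW.notMem_of_isChain4 hc (by clear * - hs hd; revert d s; decide) le_rfl

theorem hook_or_isolated_of_mem_plusCorners (hW : ComponentsCardLE adj4 W 6) (hs : s ∈ signs)
    (hc : c ∈ plusCorners W s) (hdiag : 2 ≤ blockCount W (c + (s.1 + lo s.1, s.2 + lo s.2)))
    (hcol : 2 ≤ blockCount W (c + (2 * s.1 + lo s.1, lo s.2)))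
    (hrow : 2 ≤ blockCount W (c + (lo s.1, 2 * s.2 + lo s.2))) :
    c + (2 * s.1, 2 * s.2) ∈ isolated W ∨
      c + (2 * s.1 + lo s.1, 2 * s.2 + lo (-s.2)) ∈ verticalHooks W s ∨
      c + (2 * s.1 + lo (-s.1), 2 * s.2 + lo s.2) ∈ horizontalHooks W s := by
  have hblack := notMem_of_mem_plusCorners hW hs hc
  simp only [List.forall_mem_cons] at hblack
  obtain ⟨hb1, hb2, hb3, hb4, -⟩ := hblack
  have hw1 : c + (2 * s.1, 2 * s.2) ∈ W := mem_of_two_le_blockCount hdiag hb2 hb4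
    (by clear * - hs; revert s; decide)
  have hw2 : ∀ f ∈ [(3 * s.1, 0), (3 * s.1, s.2)], c + f ∈ W := fun f hf =>
    mem_of_two_le_blockCount hcol hb1 hb2 (by clear * - hs hf; revert f s; decide)
  have hw3 : ∀ f ∈ [(0, 3 * s.2), (s.1, 3 * s.2)], c + f ∈ W := fun f hf =>
    mem_of_two_le_blockCount hrow hb3 hb4 (by clear * - hs hf; revert f s; decide)
  simp only [List.forall_mem_cons] at hw2 hw3
  clear hdiag hcol hrow hc
  by_cases hhor : c + (3 * s.1, 2 * s.2) ∈ W
  · refine Or.inr (Or.inl ?_)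
    simp only [verticalHooks, Set.mem_ofPred_eq, add_assoc, Prod.mk_add_mk]
    rcases mem_signs_iff.1 hs with rfl | rfl | rfl | rfl <;> norm_num [lo] at * <;> tauto
  by_cases hver : c + (2 * s.1, 3 * s.2) ∈ W
  · refine Or.inr (Or.inr ?_)
    simp only [horizontalHooks, Set.mem_ofPred_eq, add_assoc, Prod.mk_add_mk]
    rcases mem_signs_iff.1 hs with rfl | rfl | rfl | rfl <;> norm_num [lo] at * <;> tauto
  · refine Or.inl ⟨hw1, fun q hq hadj => ?_⟩
    have hq' := adj4_signs hs hadj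
    simp only [add_assoc, Prod.mk_add_mk] at hq'
    ring_nf at hq' hb1 hb2 hb3 hb4 hhor hver
    rcases hq' with rfl | rfl | rfl | rfl <;> contradiction

theorem mem_of_mem_plusCorners (hW : ComponentsCardLE adj4 W 6) (hs : s ∈ signs)
    (hc : c ∈ plusCorners W s) :
    c + (2 * s.1, 2 * s.2) ∈ isolated W ∨
      c + (2 * s.1 + lo s.1, 2 * s.2 + lo (-s.2)) ∈ verticalHooks W s ∨
      c + (2 * s.1 + lo (-s.1), 2 * s.2 + lo s.2) ∈ horizontalHooks W s ∨
      c + (s.1 + lo s.1, s.2 + lo s.2) ∈ loneCorners W s ∨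
      c + (2 * s.1 + lo s.1, lo s.2) ∈ blackColumns W s ∨
      c + (lo s.1, 2 * s.2 + lo s.2) ∈ blackRows W s := by
  have hblack := notMem_of_mem_plusCorners hW hs hc
  simp only [List.forall_mem_cons] at hblack
  obtain ⟨hb1, hb2, hb3, hb4, -⟩ := hblack
  have hdiag (h : blockCount W (c + (s.1 + lo s.1, s.2 + lo s.2)) ≤ 1) :
      c + (s.1 + lo s.1, s.2 + lo s.2) ∈ loneCorners W s :=
    ⟨h, by simpa [add_assoc] using hc s List.mem_cons_self⟩
  have hcol (h : blockCount W (c + (2 * s.1 + lo s.1, lo s.2)) ≤ 1) :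
      c + (2 * s.1 + lo s.1, lo s.2) ∈ blackColumns W s := by
    refine ⟨h, ?_⟩
    simp only [add_assoc, Prod.mk_add_mk]
    rcases mem_signs_iff.1 hs with rfl | rfl | rfl | rfl <;> simp [lo] at * <;> tauto
  have hrow (h : blockCount W (c + (lo s.1, 2 * s.2 + lo s.2)) ≤ 1) :
      c + (lo s.1, 2 * s.2 + lo s.2) ∈ blackRows W s := by
    refine ⟨h, ?_⟩
    simp only [add_assoc, Prod.mk_add_mk]
    rcases mem_signs_iff.1 hs with rfl | rfl | rfl | rfl <;> simp [lo] at * <;> tauto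
  have hbend := hook_or_isolated_of_mem_plusCorners hW hs hc
  grind

theorem ind_plusCorners_le (hW : ComponentsCardLE adj4 W 6) (hs : s ∈ signs) (c : ℤ × ℤ) :
    ind (plusCorners W s) c ≤ ind (isolated W) (c + (2 * s.1, 2 * s.2)) +
      ind (verticalHooks W s) (c + (2 * s.1 + lo s.1, 2 * s.2 + lo (-s.2))) +
      ind (horizontalHooks W s) (c + (2 * s.1 + lo (-s.1), 2 * s.2 + lo s.2)) +
      ind (loneCorners W s) (c + (s.1 + lo s.1, s.2 + lo s.2)) +
      ind (blackColumns W s) (c + (2 * s.1 + lo s.1, lo s.2)) +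
      ind (blackRows W s) (c + (lo s.1, 2 * s.2 + lo s.2)) := by
  have hisolated := ind_nonneg (isolated W) (c + (2 * s.1, 2 * s.2))
  have hver := ind_nonneg (verticalHooks W s) (c + (2 * s.1 + lo s.1, 2 * s.2 + lo (-s.2)))
  have hhor := ind_nonneg (horizontalHooks W s) (c + (2 * s.1 + lo (-s.1), 2 * s.2 + lo s.2))
  have hlone := ind_nonneg (loneCorners W s) (c + (s.1 + lo s.1, s.2 + lo s.2))
  have hcol := ind_nonneg (blackColumns W s) (c + (2 * s.1 + lo s.1, lo s.2))
  have hrow := ind_nonneg (blackRows W s) (c + (lo s.1, 2 * s.2 + lo s.2))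
  by_cases hc : c ∈ plusCorners W s
  · rw [ind_of_mem hc]
    rcases mem_of_mem_plusCorners hW hs hc with h | h | h | h | h | h <;> rw [ind_of_mem h] <;>
      linarith
  · rw [ind_of_notMem hc]
    positivity

theorem avgNonpos_plusCorners_sub (hW : ComponentsCardLE adj4 W 6) :
    AvgNonpos fun x => ∑ s ∈ signs, ind (plusCorners W s) x - 4 * ind (isolated W) x -
      hookCount W x - 5 * slack W x := by
  have hplus (s) (hs : s ∈ signs) : AvgNonpos fun x =>
      ind (plusCorners W s) x - ind (isolated W) x -
        (ind (verticalHooks W s) x + ind (horizontalHooks W s) x) -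
        (ind (loneCorners W s) x + ind (blackColumns W s) x + ind (blackRows W s) x) := by
    have hshift (S : Set (ℤ × ℤ)) := avgNonpos_shift_sub (abs_ind_le_one S)
    refine ((((((hshift (isolated W) (2 * s.1, 2 * s.2)).add
      (hshift (verticalHooks W s) (2 * s.1 + lo s.1, 2 * s.2 + lo (-s.2)))).add
      (hshift (horizontalHooks W s) (2 * s.1 + lo (-s.1), 2 * s.2 + lo s.2))).add
      (hshift (loneCorners W s) (s.1 + lo s.1, s.2 + lo s.2))).add
      (hshift (blackColumns W s) (2 * s.1 + lo s.1, lo s.2))).add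
      (hshift (blackRows W s) (lo s.1, 2 * s.2 + lo s.2))).mono fun x => ?_
    linarith [ind_plusCorners_le hW hs x]
  refine (AvgNonpos.sum signs hplus).mono fun x => ?_
  rw [sum_sub_distrib, sum_sub_distrib, sum_sub_distrib, sum_const, card_signs, nsmul_eq_mul,
    ← hookCount]
  push_cast
  linarith [sum_ind_lone_le_slack W x]

theorem mem_of_diagRect_full {C : Finset (ℤ × ℤ)} (h : ↑C ⊆ diagRect a a' m n)
    (hfull : m * n ≤ 2 * #C) (hp : p ∈ diagRect a a' m n) : p ∈ C := by
  by_contra hpC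
  have hcard : 2 * #(insert p C) ≤ m * n + 1 := two_mul_card_le_of_subset_diagRect (by
    rw [coe_insert]
    exact Set.insert_subset hp h)
  rw [card_insert_of_notMem hpC] at hcard
  lia

theorem ComponentsCardLE.seven_le_and_exists_notMem_of_hook (hW : ComponentsCardLE adj4 W k)
    (hs : s ∈ signs) (hv : v ∈ blocksMeeting (comp adj4 W x)) (hexc : excess W v ≠ 0)
    (hhook : v ∈ verticalHooks W s ∨ v ∈ horizontalHooks W s)
    (hrect : ↑(comp adj4 W x) ⊆ diagRect a a' m n) :
    7 ≤ m + n ∧ ∃ p ∉ W, p ∈ diagRect a a' m n := by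
  have hblock (e) (he : e ∈ corners) := hW.mem_comp_of_excess_ne_zero hv hexc he
  rcases hhook with ⟨h1, h2, h3, h4, h5, -⟩ | ⟨h1, h2, h3, h4, h5, -⟩
  all_goals
    have hc1 := hblock _ (by clear * - hs; revert s; decide) h1
    have hc2 := hblock _ (by clear * - hs; revert s; decide) h2
    have hc3 := hblock _ (by clear * - hs; revert s; decide) h3
    have hc4 := hW.mem_comp_of_adj hc3 h4 (adj4_add_iff.2 (by clear * - hs; revert s; decide))
    have hr1 := hrect hc1
    have hr2 := hrect hc2
    have hr3 := hrect hc3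
    have hr4 := hrect hc4
    clear hW hexc hblock h1 h2 h3 h4 hc1 hc2 hc3 hc4
    rw [and_comm]
    refine ⟨⟨_, h5, ?_⟩, ?_⟩ <;>
      simp only [diagRect, Set.mem_ofPred_eq, Set.mem_Ico, diagSum, diagDiff, Prod.fst_add,
        Prod.snd_add] at * <;>
      rcases mem_signs_iff.1 hs with rfl | rfl | rfl | rfl <;> simp [lo] at * <;> lia

theorem exists_mem_plusCorners_of_diagRect_subset {C : Set (ℤ × ℤ)}
    (hmn : m = 3 ∧ n = 4 ∨ m = 4 ∧ n = 3) (h : diagRect a a' m n ⊆ C) :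
    ∃ c ∈ C, ∃ s ∈ signs, c ∈ plusCorners C s := by
  suffices ∃ c : ℤ × ℤ, ∃ s ∈ signs, c ∈ plusCorners C s by
    obtain ⟨c, s, hs, hc⟩ := this
    exact ⟨c, by simpa [Prod.mk_zero_zero] using hc (0, 0) (by simp), s, hs, hc⟩
  obtain ⟨t, ht⟩ := Int.even_or_odd' (a + a')
  rcases hmn with ⟨rfl, rfl⟩ | ⟨rfl, rfl⟩ <;> rcases ht with ht | ht
  on_goal 1 => refine ⟨(t + 1, a - t), (1, -1), by decide, fun d hd => h ?_⟩
  on_goal 2 => refine ⟨(t + 2, a - t - 1), (-1, 1), by decide, fun d hd => h ?_⟩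
  on_goal 3 => refine ⟨(t + 1, a - t), (1, 1), by decide, fun d hd => h ?_⟩
  on_goal 4 => refine ⟨(t + 2, a - t), (-1, -1), by decide, fun d hd => h ?_⟩
  all_goals
    simp only [List.mem_cons, List.not_mem_nil, or_false] at hd
    rcases hd with rfl | rfl | rfl | rfl | rfl | rfl <;>
      simp only [diagRect, Set.mem_ofPred_eq, Set.mem_Ico, diagSum, diagDiff, Prod.mk_add_mk] <;>
      lia

theorem six_mul_add_ite_le_or {j : ℕ} (hj : j ≤ 6) (hm : 1 ≤ m) (hn : 1 ≤ n)
    (h : 2 * j ≤ m * n + 1) :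
    6 * j + (if j = 1 then 4 else 0) ≤ 5 * (m + n) ∨
      j = 6 ∧ (m = 3 ∧ n = 4 ∨ m = 4 ∧ n = 3) := by
  rcases le_or_gt 8 (m + n) with h8 | h8
  · left
    split_ifs <;> lia
  · have hm7 : m ≤ 6 := by lia
    interval_cases m <;> split_ifs <;> lia

theorem four_mul_add_ite_le_of_seven_le {j : ℕ} (hj : j ≤ 6) (h7 : 7 ≤ m + n)
    (h : 2 * j < m * n) :
    4 * j + (if j = 1 then 2 else 0) ≤ 3 * (m + n) := by
  rcases le_or_gt 8 (m + n) with h8 | h8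
  · split_ifs <;> lia
  · have hm7 : m ≤ 7 := by lia
    interval_cases m <;> split_ifs <;> lia

theorem exists_hook_of_hookCount_ne_zero (h : hookCount W v ≠ 0) :
    ∃ s ∈ signs, v ∈ verticalHooks W s ∨ v ∈ horizontalHooks W s := by
  by_contra! hnot
  refine h (sum_eq_zero fun s hs => ?_)
  rw [ind_of_notMem (hnot s hs).1, ind_of_notMem (hnot s hs).2, add_zero]

namespace ComponentsCardLE

theorem sum_excess_le_of_hook (hW : ComponentsCardLE adj4 W 6) (hx : x ∈ W)
    (hv : v ∈ blocksMeeting (comp adj4 W x)) (hhook : hookCount W v ≠ 0) :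
    6 * ∑ v ∈ blocksMeeting (comp adj4 W x), excess W v +
      4 * ∑ y ∈ comp adj4 W x, ind (isolated W) y ≤ 4 * #(comp adj4 W x) := by
  obtain ⟨a, a', m, n, -, -, hrect, hexc⟩ := hW.exists_comp_subset_diagRect hx
  obtain ⟨s, hs, hvs⟩ := exists_hook_of_hookCount_ne_zero hhook
  obtain ⟨h7, p, hpW, hp⟩ := hW.seven_le_and_exists_notMem_of_hook hs hv
    (fun h => hhook (hookCount_eq_zero_of_excess_eq_zero h)) hvs hrect
  have hnotfull : 2 * #(comp adj4 W x) < m * n := by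
    by_contra! hfull
    exact hpW (hW.mem_of_mem_comp (mem_of_diagRect_full hrect hfull hp))
  have hmn : (4 * #(comp adj4 W x) + (if #(comp adj4 W x) = 1 then 2 else 0) : ℝ) ≤
      3 * (m + n) := by
    exact_mod_cast four_mul_add_ite_le_of_seven_le (hW.card_comp_le x) h7 hnotfull
  have hisolated := hW.sum_comp_ind_isolated_le x
  split_ifs at hmn hisolated <;> linarith

theorem one_le_sum_ind_plusCorners (hW : ComponentsCardLE adj4 W k)
    (hmn : m = 3 ∧ n = 4 ∨ m = 4 ∧ n = 3) (hcard : #(comp adj4 W x) = 6)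
    (hrect : ↑(comp adj4 W x) ⊆ diagRect a a' m n) :
    1 ≤ ∑ y ∈ comp adj4 W x, ∑ s ∈ signs, ind (plusCorners W s) y := by
  have hfull : m * n ≤ 2 * #(comp adj4 W x) := by
    rcases hmn with ⟨rfl, rfl⟩ | ⟨rfl, rfl⟩ <;> rw [hcard]
  obtain ⟨c, hc, s, hs, hcs⟩ := exists_mem_plusCorners_of_diagRect_subset hmn
    (fun p hp => mem_coe.2 (mem_of_diagRect_full hrect hfull hp))
  have hcW : c ∈ plusCorners W s := fun d hd => hW.mem_of_mem_comp (mem_coe.1 (hcs d hd))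
  calc 1 = ind (plusCorners W s) c := (ind_of_mem hcW).symm
    _ ≤ ∑ s ∈ signs, ind (plusCorners W s) c :=
        single_le_sum (f := fun s => ind (plusCorners W s) c) (fun _ _ => ind_nonneg _ _) hs
    _ ≤ _ := single_le_sum (f := fun y => ∑ s ∈ signs, ind (plusCorners W s) y)
        (fun _ _ => sum_nonneg fun _ _ => ind_nonneg _ _) (mem_coe.1 hc)

theorem sum_excess_le_add_plusCorners (hW : ComponentsCardLE adj4 W 6) (hx : x ∈ W) :
    5 * ∑ v ∈ blocksMeeting (comp adj4 W x), excess W v +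
      4 * ∑ y ∈ comp adj4 W x, ind (isolated W) y ≤
      4 * #(comp adj4 W x) + ∑ y ∈ comp adj4 W x, ∑ s ∈ signs, ind (plusCorners W s) y := by
  obtain ⟨a, a', m, n, hm, hn, hrect, hexc⟩ := hW.exists_comp_subset_diagRect hx
  have hisolated := hW.sum_comp_ind_isolated_le x
  rcases six_mul_add_ite_le_or (hW.card_comp_le x) hm hn
    (two_mul_card_le_of_subset_diagRect hrect) with hmn | ⟨hcard, hmn⟩
  · have hplus : 0 ≤ ∑ y ∈ comp adj4 W x, ∑ s ∈ signs, ind (plusCorners W s) y :=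
      sum_nonneg fun _ _ => sum_nonneg fun _ _ => ind_nonneg _ _
    have hmn : (6 * #(comp adj4 W x) + (if #(comp adj4 W x) = 1 then 4 else 0) : ℝ) ≤
        5 * (m + n) := by exact_mod_cast hmn
    split_ifs at hmn hisolated <;> linarith
  · have hplus := hW.one_le_sum_ind_plusCorners hmn hcard hrect
    have hmn : (m + n : ℝ) = 7 := by
      rcases hmn with ⟨rfl, rfl⟩ | ⟨rfl, rfl⟩ <;> norm_num
    norm_num [hcard] at hisolated hexc ⊢
    linarith

theorem sum_excess_add_hookCount_le (hW : ComponentsCardLE adj4 W 6) (hx : x ∈ W) :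
    ∑ v ∈ blocksMeeting (comp adj4 W x), (excess W v + 1 / 5 * hookCount W v) +
      4 / 5 * ∑ y ∈ comp adj4 W x, ind (isolated W) y ≤ 4 / 5 * #(comp adj4 W x) +
        1 / 5 * ∑ y ∈ comp adj4 W x, ∑ s ∈ signs, ind (plusCorners W s) y := by
  rw [sum_add_distrib, ← mul_sum]
  by_cases hhook : ∃ v ∈ blocksMeeting (comp adj4 W x), hookCount W v ≠ 0
  · obtain ⟨v, hv, hvhook⟩ := hhook
    have hplus : 0 ≤ ∑ y ∈ comp adj4 W x, ∑ s ∈ signs, ind (plusCorners W s) y :=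
      sum_nonneg fun _ _ => sum_nonneg fun _ _ => ind_nonneg _ _
    have hle := sum_le_sum fun v (_ : v ∈ blocksMeeting (comp adj4 W x)) =>
      hookCount_le_excess W v
    linarith [hW.sum_excess_le_of_hook hx hv hvhook]
  · push Not at hhook
    rw [sum_eq_zero hhook]
    linarith [hW.sum_excess_le_add_plusCorners hx]

end ComponentsCardLE

theorem avgNonpos_excess_add_hookCount (hW : ComponentsCardLE adj4 W 6) :
    AvgNonpos fun x => excess W x + 1 / 5 * hookCount W x +
      (4 / 5 * ind (isolated W) x - 4 / 5 * ind W x -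
        1 / 5 * ∑ s ∈ signs, ind (plusCorners W s) x) := by
  have hplus (x) : 0 ≤ ∑ s ∈ signs, ind (plusCorners W s) x :=
    sum_nonneg fun _ _ => ind_nonneg _ _
  have hzero (v) (hv : excess W v = 0) : excess W v + 1 / 5 * hookCount W v = 0 := by
    rw [hookCount_eq_zero_of_excess_eq_zero hv, hv, mul_zero, add_zero]
  refine hW.avgNonpos_add adj4_le_adj8 (F := fun v => excess W v + 1 / 5 * hookCount W v)
    (B := 3) (D := 1) (fun v => ?_)
    (fun v hv => hzero v (excess_eq_zero_of_blockCount_le (by lia)))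
    (fun x v hv hne e he => hW.mem_comp_of_excess_ne_zero hv (mt (hzero v) hne) he)
    (fun x => ?_) (fun x hx => ?_) fun x hx => ?_
  · have hexc := abs_le.1 (abs_excess_le W v)
    have hexc0 := excess_nonneg W v
    have hhook0 := hookCount_nonneg W v
    have hhook := hookCount_le_excess W v
    exact abs_le.2 ⟨by linarith, by linarith⟩
  · linarith [ind_le_one (isolated W) x, ind_nonneg W x, hplus x]
  · rw [ind_of_notMem hx, ind_of_notMem fun h => hx h.1]
    linarith [hplus x]
  · rw [sum_sub_distrib, sum_sub_distrib, ← mul_sum, ← mul_sum, ← mul_sum, sum_comp_ind hW]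
    linarith [hW.sum_excess_add_hookCount_le hx]

theorem density_le_of_components_card_le_six (hW : ComponentsCardLE adj4 W 6) :
    density W ≤ 5 / 8 := by
  refine density_le_of_avgNonpos <| ((((avgNonpos_ind_sub_excess_add_slack W).add
    ((avgNonpos_plusCorners_sub hW).const_mul (by norm_num : (0 : ℝ) ≤ 1 / 5))).add
    (avgNonpos_excess_add_hookCount hW)).const_mul
    (by norm_num : (0 : ℝ) ≤ 5 / 16)).mono fun x => ?_
  linarith

end SixPixels

section Periodic

/-! ### Periodic images -/

theorem ComponentsCardLE.of_label {V α : Type*} {G : SimpleGraph V} {W : Set V} {k : ℕ}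
    {label : V → α} (hlabel : ∀ x ∈ W, ∀ y ∈ W, G.Adj x y → label x = label y)
    {T : α → Finset V} (hT : ∀ x ∈ W, x ∈ T (label x)) (hcard : ∀ l, #(T l) ≤ k) :
    ComponentsCardLE G W k := by
  intro c
  induction c using SimpleGraph.ConnectedComponent.ind with | _ x => ?_
  have hreach (y : W) (hxy : Relation.ReflTransGen (G.induce W).Adj x y) : label y = label x := by
    induction hxy with
    | refl => rfl
    | @tail y z _ hyz ih => exact (hlabel y y.2 z z.2 hyz).symm.trans ih
  have hsub : Subtype.val '' ((G.induce W).connectedComponentMk x).supp ⊆ ↑(T (label x)) := by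
    rintro _ ⟨y, hy, rfl⟩
    have hxy : (G.induce W).Reachable x y := (SimpleGraph.ConnectedComponent.eq.1 hy).symm
    rw [← hreach y ((SimpleGraph.reachable_iff_reflTransGen _ _).1 hxy)]
    exact hT y y.2
  rw [← Subtype.val_injective.encard_image]
  refine (Set.encard_le_encard hsub).trans ?_
  rw [Set.encard_coe_eq_coe_finsetCard]
  exact_mod_cast hcard (label x)

variable {A ι : Type*} [AddCommGroup A] {φ : ℤ × ℤ →+ A} {P : ι → Finset (ℤ × ℤ)}
  {D : Finset (ℤ × ℤ)}

theorem card_div_card_le_density_preimage [Fintype A] (hφ : Function.Surjective φ)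
    (S : Finset A) : (#S : ℝ) / Fintype.card A ≤ density (φ ⁻¹' S) := by
  classical
  obtain ⟨σ, hσ⟩ := hφ.hasRightInverse
  have hcount (x : ℤ × ℤ) : ∑ a, ind (φ ⁻¹' S) (x + σ a) = #S := by
    have hind (a : A) : ind (φ ⁻¹' S) (x + σ a) = ind (S : Set A) (φ x + a) := by
      simp only [ind, Set.indicator, Set.mem_preimage, map_add, hσ a, Pi.one_apply]
    calc ∑ a, ind (φ ⁻¹' S) (x + σ a) = ∑ a, ind (S : Set A) (φ x + a) := by simp only [hind]
      _ = ∑ a, ind (S : Set A) a := Equiv.sum_comp (Equiv.addLeft (φ x)) (ind (S : Set A))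
      _ = #S := by simp [ind, Set.indicator]
  have hA : (0 : ℝ) < Fintype.card A := by exact_mod_cast Fintype.card_pos
  refine le_density_of_avgNonpos (((AvgNonpos.sum univ fun a _ => avgNonpos_shift_sub
    (abs_ind_le_one (φ ⁻¹' (S : Set A))) (σ a)).const_mul (inv_nonneg.2 hA.le)).mono fun x => ?_)
  rw [sum_sub_distrib, hcount, sum_const, card_univ, nsmul_eq_mul]
  exact le_of_eq (by field_simp)

/-- The translates of the shapes `P i` by the lattice `ker φ` are separated from each other: no
displacement in `D` leads from a pixel of one translate to a pixel of a different one. -/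
def IsSeparated (D : Finset (ℤ × ℤ)) (φ : ℤ × ℤ →+ A) (P : ι → Finset (ℤ × ℤ)) : Prop :=
  ∀ i j, ∀ p ∈ P i, ∀ q ∈ P j, ∀ d ∈ D, φ q = φ p + φ d → i = j ∧ q = p + d

/-- The union of the translates of the shapes `P i` by the lattice `ker φ`. -/
def tiling (φ : ℤ × ℤ →+ A) (P : ι → Finset (ℤ × ℤ)) : Set (ℤ × ℤ) :=
  {x | ∃ i, ∃ p ∈ P i, φ x = φ p}

namespace IsSeparated

theorem componentsCardLE_tiling (hP : IsSeparated D φ P) {G : SimpleGraph (ℤ × ℤ)}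
    (hD : ∀ x y, G.Adj x y → y - x ∈ D) {k : ℕ} (hk : ∀ i, #(P i) ≤ k) :
    ComponentsCardLE G (tiling φ P) k := by
  classical
  rcases isEmpty_or_nonempty ι with hι | hι
  · intro c
    induction c using SimpleGraph.ConnectedComponent.ind with | _ x => exact hι.elim x.2.choose
  have hshape (x : ℤ × ℤ) : ∃ i p, x ∈ tiling φ P → p ∈ P i ∧ φ x = φ p := by
    by_cases hx : x ∈ tiling φ P
    · obtain ⟨i, p, hp⟩ := hx
      exact ⟨i, p, fun _ => hp⟩
    · exact ⟨hι.some, 0, fun h => absurd h hx⟩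
  choose shape pos hpos using hshape
  refine .of_label (label := fun x => (shape x, x - pos x)) (fun x hx y hy hxy => ?_)
    (T := fun l => (P l.1).image (l.2 + ·)) (fun x hx => ?_)
    (fun l => card_image_le.trans (hk l.1))
  · obtain ⟨hx, hφx⟩ := hpos x hx
    obtain ⟨hy, hφy⟩ := hpos y hy
    obtain ⟨hshape, hpos⟩ := hP _ _ _ hx _ hy _ (hD x y hxy) (by rw [← hφx, ← hφy, map_sub]; abel)
    rw [hshape, hpos]
    congr 1
    abel
  · exact mem_image.2 ⟨pos x, (hpos x hx).1, sub_add_cancel _ _⟩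

theorem sum_card_div_card_le_density_tiling [Fintype A] [Fintype ι] (hP : IsSeparated D φ P)
    (h0 : 0 ∈ D) (hφ : Function.Surjective φ) :
    ((∑ i, #(P i) : ℕ) : ℝ) / Fintype.card A ≤ density (tiling φ P) := by
  classical
  have hcard : #((univ.sigma P).image fun ip => φ ip.2) = ∑ i, #(P i) := by
    rw [card_image_of_injOn, card_sigma]
    rintro ⟨i, p⟩ hp ⟨j, q⟩ hq hpq
    obtain ⟨rfl, h⟩ := hP i j p (mem_sigma.1 hp).2 q (mem_sigma.1 hq).2 0 h0
      (by rw [map_zero, add_zero]; exact hpq.symm)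
    rw [h, add_zero]
  have htiling : tiling φ P = φ ⁻¹' ((univ.sigma P).image fun ip => φ ip.2 : Finset A) := by
    ext x
    simp [tiling, eq_comm]
  rw [← hcard, htiling]
  exact card_div_card_le_density_preimage hφ _

end IsSeparated

/-- The residue modulo `N` of the linear form `α x + β y`. -/
def residue (N : ℕ) (α β : ℤ) : ℤ × ℤ →+ ZMod N :=
  (Int.castAddHom (ZMod N)).comp (α • AddMonoidHom.fst ℤ ℤ + β • AddMonoidHom.snd ℤ ℤ)

theorem residue_eq_add_iff {N : ℕ} {α β : ℤ} {p q d : ℤ × ℤ} :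
    residue N α β q = residue N α β p + residue N α β d ↔
      (N : ℤ) ∣ α * (q.1 - p.1 - d.1) + β * (q.2 - p.2 - d.2) := by
  rw [← ZMod.intCast_zmod_eq_zero_iff_dvd, ← sub_eq_zero]
  simp only [residue, AddMonoidHom.comp_apply, AddMonoidHom.add_apply, AddMonoidHom.smul_apply,
    AddMonoidHom.coe_fst, AddMonoidHom.coe_snd, Int.coe_castAddHom, smul_eq_mul]
  push_cast
  ring_nf

theorem residue_surjective (N : ℕ) {α β : ℤ} (h : IsCoprime α β) :
    Function.Surjective (residue N α β) := by
  obtain ⟨a, b, hab⟩ := h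
  intro z
  obtain ⟨n, rfl⟩ := ZMod.intCast_surjective z
  refine ⟨(a * n, b * n), congrArg Int.cast ?_⟩
  change α * (a * n) + β * (b * n) = n
  linear_combination n * hab

theorem exists_density_of_isSeparated [Fintype ι] {G : SimpleGraph (ℤ × ℤ)}
    (hD : ∀ x y, G.Adj x y → y - x ∈ D) (h0 : 0 ∈ D) {N : ℕ} [NeZero N] {α β : ℤ}
    (hαβ : IsCoprime α β) (hP : IsSeparated D (residue N α β) P) {k : ℕ} (hk : ∀ i, #(P i) ≤ k) :
    ∃ W, maxCC G W ≤ k ∧ ((∑ i, #(P i) : ℕ) : ℝ) / N ≤ density W := by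
  refine ⟨tiling (residue N α β) P, maxCC_le_iff.2 (hP.componentsCardLE_tiling hD hk), ?_⟩
  simpa only [ZMod.card] using hP.sum_card_div_card_le_density_tiling h0 (residue_surjective N hαβ)

theorem exists_density_of_isSeparated_single {G : SimpleGraph (ℤ × ℤ)} {P : Finset (ℤ × ℤ)}
    (hD : ∀ x y, G.Adj x y → y - x ∈ D) (h0 : 0 ∈ D) {N : ℕ} [NeZero N] {α β : ℤ}
    (hαβ : IsCoprime α β) (hP : IsSeparated D (residue N α β) fun _ : Unit => P) :
    ∃ W, maxCC G W ≤ #P ∧ (#P : ℝ) / N ≤ density W := by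
  simpa using exists_density_of_isSeparated hD h0 hαβ hP fun _ => le_rfl

/-- The displacements of `ℓ₁` length at most `1`. -/
def disp4 : Finset (ℤ × ℤ) := {0, (1, 0), (-1, 0), (0, 1), (0, -1)}

/-- The displacements of `ℓ∞` length at most `1`. -/
noncomputable def disp8 : Finset (ℤ × ℤ) := Icc (-1) 1 ×ˢ Icc (-1) 1

theorem sub_mem_disp4 (x y : ℤ × ℤ) (h : adj4.Adj x y) : y - x ∈ disp4 := by
  change |x.1 - y.1| + |x.2 - y.2| = 1 at h
  simp only [disp4, mem_insert, mem_singleton, Prod.ext_iff, Prod.fst_sub, Prod.snd_sub,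
    Prod.fst_zero, Prod.snd_zero]
  grind

theorem sub_mem_disp8 (x y : ℤ × ℤ) (h : adj8.Adj x y) : y - x ∈ disp8 := by
  have h := adj8_abs_sub_le_one h
  simp only [disp8, mem_product, mem_Icc, Prod.fst_sub, Prod.snd_sub]
  grind

end Periodic

section Rectangles

/-! ### Rectangles, diagonal rectangles and diamonds -/

theorem eq_zero_of_mul_eq_of_abs_lt {A u v : ℤ} (h : A * u = v) (hv : |v| < A) :
    u = 0 ∧ v = 0 := by
  have hv0 : v = 0 := Int.eq_zero_of_abs_lt_dvd ⟨u, h.symm⟩ hv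
  have hA : A ≠ 0 := ((abs_nonneg v).trans_lt hv).ne'
  exact ⟨(mul_eq_zero.1 (h.trans hv0)).resolve_left hA, hv0⟩

/-- `b` rows of `a` pixels, and a further row of `p` pixels. -/
noncomputable def rectShape (a b p : ℕ) : Finset (ℤ × ℤ) :=
  Ico 0 (a : ℤ) ×ˢ Ico 0 (b : ℤ) ∪ Ico 0 (p : ℤ) ×ˢ {(b : ℤ)}

theorem card_rectShape (a b p : ℕ) : #(rectShape a b p) = a * b + p := by
  rw [rectShape, card_union_of_disjoint]
  · simp
  · simp [disjoint_left]
    grind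

theorem bounds_of_mem_rectShape {a b p : ℕ} (hp : p ≤ a) {x : ℤ × ℤ} (hx : x ∈ rectShape a b p) :
    0 ≤ x.1 ∧ x.1 < a ∧ 0 ≤ x.1 + (a + 1) * x.2 ∧ x.1 + (a + 1) * x.2 < (a + 1) * b + p := by
  simp only [rectShape, mem_union, mem_product, mem_Ico, mem_singleton] at hx
  rcases hx with ⟨⟨_, _⟩, _, _⟩ | ⟨⟨_, _⟩, hb⟩
  · refine ⟨by lia, by lia, by positivity, ?_⟩
    nlinarith
  · rw [hb]
    exact ⟨by lia, by lia, by positivity, by lia⟩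

theorem isSeparated_rectShape {a b p : ℕ} (hp : p ≤ a) :
    IsSeparated disp8 (residue ((a + 1) * b + p + a + 2) 1 (a + 1))
      fun _ : Unit => rectShape a b p := by
  intro _ _ x hx y hy d hd h
  obtain ⟨hx₀, hxa, hx₁, hxN⟩ := bounds_of_mem_rectShape hp hx
  obtain ⟨hy₀, hya, hy₁, hyN⟩ := bounds_of_mem_rectShape hp hy
  simp only [disp8, mem_product, mem_Icc] at hd
  have hd₂ : |(a + 1) * d.2| ≤ (a + 1 : ℤ) := by
    rw [abs_mul, abs_of_nonneg (by positivity)]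
    exact mul_le_of_le_one_right (by positivity) (abs_le.2 hd.2)
  rw [abs_le] at hd₂
  have hform := Int.eq_zero_of_abs_lt_dvd (residue_eq_add_iff.1 h) (by
    push_cast
    rw [abs_lt]
    constructor <;> linarith)
  obtain ⟨h₂, h₁⟩ := eq_zero_of_mul_eq_of_abs_lt (A := a + 1) (u := y.2 - x.2 - d.2)
    (v := -(y.1 - x.1 - d.1)) (by linarith) (by rw [abs_lt]; lia)
  exact ⟨rfl, Prod.ext (by rw [Prod.fst_add]; lia) (by rw [Prod.snd_add]; lia)⟩

theorem exists_density_rectShape (a b : ℕ) {p : ℕ} (hp : p ≤ a) :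
    ∃ W, maxCC adj8 W ≤ (a * b + p : ℕ) ∧
      ((a * b + p : ℕ) : ℝ) / ((a * b + p : ℕ) + (a + b + 1 : ℕ) + 1) ≤ density W := by
  obtain ⟨W, hW, hd⟩ := exists_density_of_isSeparated_single sub_mem_disp8 (by decide)
    isCoprime_one_left (isSeparated_rectShape (b := b) hp)
  rw [card_rectShape] at hW hd
  refine ⟨W, hW, le_of_eq_of_le ?_ hd⟩
  congr 1
  push_cast
  ring

/-- The pixels with diagonal coordinates `(2 y, 2 s)`, `(y, s) ∈ E`, and `(2 y + 1, 2 s + 1)`,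
`(y, s) ∈ O`. -/
def diagShape (E O : Finset (ℕ × ℕ)) : Finset (ℤ × ℤ) :=
  E.image (fun e => ((e.1 + e.2 : ℤ), (e.1 - e.2 : ℤ))) ∪
    O.image fun e => ((e.1 + e.2 + 1 : ℤ), (e.1 - e.2 : ℤ))

theorem card_diagShape (E O : Finset (ℕ × ℕ)) : #(diagShape E O) = #E + #O := by
  rw [diagShape, card_union_of_disjoint, card_image_of_injective, card_image_of_injective]
  · intro e f h
    simp only [Prod.ext_iff] at h ⊢
    lia
  · intro e f h
    simp only [Prod.ext_iff] at h ⊢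
    lia
  · simp only [disjoint_left, mem_image, not_exists, not_and]
    rintro _ ⟨e, -, rfl⟩ f -
    simp only [Prod.ext_iff]
    lia

theorem abs_diag_le_one_of_mem_disp4 {d : ℤ × ℤ} (hd : d ∈ disp4) :
    |diagSum d| ≤ 1 ∧ |diagDiff d| ≤ 1 := by
  revert d
  decide

theorem eq_add_of_diag_eq {p q d : ℤ × ℤ} (hsum : diagSum q - diagSum p - diagSum d = 0)
    (hdiff : diagDiff q - diagDiff p - diagDiff d = 0) : q = p + d := by
  simp only [diagSum, diagDiff] at hsum hdiff
  exact Prod.ext (by rw [Prod.fst_add]; lia) (by rw [Prod.snd_add]; lia)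

/-- A diagonal rectangle with sides `2 a` and `2 b`, without `m` pixels of its last side. -/
def diagRectShape (a b m : ℕ) : Finset (ℤ × ℤ) :=
  diagShape (range a ×ˢ range b) (range a ×ˢ range b \ {a - 1} ×ˢ range m)

theorem card_diagRectShape {a b m : ℕ} (ha : 1 ≤ a) (hm : m ≤ b) :
    #(diagRectShape a b m) = 2 * a * b - m := by
  have hsub : {a - 1} ×ˢ range m ⊆ range a ×ˢ range b :=
    product_subset_product (by simpa using Nat.lt_of_lt_of_le zero_lt_one ha) (range_mono hm)
  have hle := card_le_card hsub
  rw [diagRectShape, card_diagShape, card_sdiff_of_subset hsub]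
  simp only [card_product, card_range, card_singleton] at hle ⊢
  lia

theorem bounds_of_mem_diagRectShape {a b m : ℕ} (hm : m ≤ b) {x : ℤ × ℤ}
    (hx : x ∈ diagRectShape a b m) :
    0 ≤ diagDiff x ∧ diagDiff x < 2 * b ∧ -(b : ℤ) < b * x.1 + (b + 1) * x.2 ∧
      b * x.1 + (b + 1) * x.2 ≤ (2 * b + 1) * (a - 1) + b - m := by
  simp only [diagRectShape, diagShape, mem_union, mem_image, Finset.mem_sdiff, mem_product,
    mem_range, mem_singleton] at hx
  have hrow {y : ℕ} (hy : y < a) (t : ℤ) (ht : y + 1 = a → t ≤ b - m) (htb : t ≤ b) :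
      (2 * b + 1) * (y : ℤ) + t ≤ (2 * b + 1) * (a - 1) + b - m := by
    rcases eq_or_ne (y + 1) a with rfl | hne
    · push_cast
      linarith [ht rfl]
    · nlinarith [show (y : ℤ) + 2 ≤ a by lia]
  rcases hx with ⟨⟨y, s⟩, ⟨hy, hs⟩, rfl⟩ | ⟨⟨y, s⟩, ⟨⟨hy, hs⟩, hlast⟩, rfl⟩
  · refine ⟨by simp [diagDiff], by simp [diagDiff]; lia, by nlinarith, ?_⟩
    linarith [hrow hy (-s) (by lia) (by lia)]
  · refine ⟨by simp [diagDiff]; lia, by simp [diagDiff]; lia, by nlinarith, ?_⟩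
    linarith [hrow hy (b - s) (by lia) (by lia)]

theorem isSeparated_diagRectShape {a b m N : ℕ} (hm : m ≤ b)
    (hN : (N : ℤ) = (2 * b + 1) * (a - 1) + 3 * b + 1 - m) :
    IsSeparated disp4 (residue N b (b + 1)) fun _ : Unit => diagRectShape a b m := by
  intro _ _ x hx y hy d hd h
  obtain ⟨hx₀, hxb, hx₁, hxN⟩ := bounds_of_mem_diagRectShape hm hx
  obtain ⟨hy₀, hyb, hy₁, hyN⟩ := bounds_of_mem_diagRectShape hm hy
  obtain ⟨-, hdiff⟩ := abs_diag_le_one_of_mem_disp4 hd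
  have hd : |b * d.1 + (b + 1) * d.2| ≤ (b + 1 : ℤ) := by
    simp only [disp4, mem_insert, mem_singleton] at hd
    rcases hd with rfl | rfl | rfl | rfl | rfl <;> simp [abs_le] <;> lia
  rw [abs_le] at hd hdiff
  have hform := Int.eq_zero_of_abs_lt_dvd (residue_eq_add_iff.1 h) (by
    rw [hN, abs_lt]
    constructor <;> linarith)
  have hdiag : (2 * b + 1) * (diagSum y - diagSum x - diagSum d) =
      diagDiff y - diagDiff x - diagDiff d := by
    simp only [diagSum, diagDiff]
    linear_combination 2 * hform
  obtain ⟨hsum, hdiff⟩ := eq_zero_of_mul_eq_of_abs_lt hdiag (by rw [abs_lt]; lia)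
  exact ⟨rfl, eq_add_of_diag_eq hsum hdiff⟩

theorem exists_density_diagRectShape {a b m : ℕ} (ha : 1 ≤ a) (hb : 1 ≤ b) (hm : m ≤ b) :
    ∃ W, maxCC adj4 W ≤ (2 * a * b - m : ℕ) ∧
      ((2 * a * b - m : ℕ) : ℝ) / ((2 * a * b - m : ℕ) + (a + b : ℕ)) ≤ density W := by
  have hle : m ≤ 2 * a * b := by nlinarith
  have : NeZero (2 * a * b - m + (a + b)) := ⟨by lia⟩
  obtain ⟨W, hW, hd⟩ := exists_density_of_isSeparated_single sub_mem_disp4 (by decide)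
    (N := 2 * a * b - m + (a + b)) ⟨-1, 1, by ring⟩ (isSeparated_diagRectShape (a := a) hm (by
      push_cast [hle]
      ring))
  rw [card_diagRectShape ha hm] at hW hd
  exact ⟨W, hW, by exact_mod_cast hd⟩

/-- A translate of the `ℓ₁` ball of radius `n - 1`. -/
def diamond (n : ℕ) : Finset (ℤ × ℤ) :=
  diagShape (range n ×ˢ range n) (range (n - 1) ×ˢ range (n - 1))

theorem card_diamond (n : ℕ) : #(diamond n) = n ^ 2 + (n - 1) ^ 2 := by
  simp only [diamond, card_diagShape, card_product, card_range, sq]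

theorem bounds_of_mem_diamond {n : ℕ} {x : ℤ × ℤ} (hx : x ∈ diamond n) :
    0 ≤ diagSum x ∧ diagSum x ≤ 2 * n - 2 ∧ 0 ≤ diagDiff x ∧ diagDiff x ≤ 2 * n - 2 := by
  simp only [diamond, diagShape, mem_union, mem_image, mem_product, mem_range] at hx
  rcases hx with ⟨⟨y, s⟩, ⟨hy, hs⟩, rfl⟩ | ⟨⟨y, s⟩, ⟨hy, hs⟩, rfl⟩ <;>
  · simp only [diagSum, diagDiff]
    lia

/- In diagonal coordinates `(S, D)` the form `(2 n - 1) x + y` is `n S + (n - 1) D`; its kernel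
modulo `2 n²` is spanned by `(2 n, 0)` and `(2, 2 n)`. -/
theorem diag_eq_zero_of_dvd {n : ℕ} {S D : ℤ} (hpar : 2 ∣ S - D) (hS : |S| < 2 * n)
    (hD : |D| < 2 * n) (h : 2 * (n : ℤ) * n ∣ n * S + (n - 1) * D) : S = 0 ∧ D = 0 := by
  have hn : (0 : ℤ) < n := by linarith [abs_nonneg S]
  obtain ⟨e, he⟩ : (n : ℤ) ∣ D := by
    have h' : (n : ℤ) ∣ n * (S + D) - (n * S + (n - 1) * D) :=
      dvd_sub (dvd_mul_right _ _) ((dvd_mul_left _ _).trans h)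
    simpa [show (n : ℤ) * (S + D) - (n * S + (n - 1) * D) = D by ring] using h'
  subst he
  have he : |e| < 2 := by
    rw [abs_mul, abs_of_pos hn, mul_comm] at hD
    exact lt_of_mul_lt_mul_right hD hn.le
  have hform : 2 * (n : ℤ) ∣ S + (n - 1) * e :=
    Int.dvd_of_mul_dvd_mul_right hn.ne' (by convert h using 1; ring)
  have heven : 2 ∣ e := by
    have hdvd := dvd_sub (dvd_sub ((dvd_mul_right 2 (n : ℤ)).trans hform) hpar)
      (dvd_mul_right 2 (n * e - e))
    rwa [show S + (n - 1) * e - (S - n * e) - 2 * (n * e - e) = e by ring] at hdvd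
  obtain rfl := Int.eq_zero_of_abs_lt_dvd heven he
  exact ⟨Int.eq_zero_of_abs_lt_dvd (by simpa using hform) hS, mul_zero _⟩

theorem isSeparated_diamond (n : ℕ) :
    IsSeparated disp4 (residue (2 * n * n) (2 * n - 1) 1) fun _ : Unit => diamond n := by
  intro _ _ x hx y hy d hd h
  have hx := bounds_of_mem_diamond hx
  have hy := bounds_of_mem_diamond hy
  have hd := abs_diag_le_one_of_mem_disp4 hd
  rw [abs_le, abs_le] at hd
  have hform := residue_eq_add_iff.1 h
  push_cast at hform
  obtain ⟨hsum, hdiff⟩ := diag_eq_zero_of_dvd (n := n)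
    (S := diagSum y - diagSum x - diagSum d) (D := diagDiff y - diagDiff x - diagDiff d)
    (by simp only [diagSum, diagDiff]; lia) (by rw [abs_lt]; lia) (by rw [abs_lt]; lia)
    (by convert hform using 1; simp only [diagSum, diagDiff]; ring)
  exact ⟨rfl, eq_add_of_diag_eq hsum hdiff⟩

theorem exists_density_diamond {n : ℕ} (hn : 1 ≤ n) :
    ∃ W, maxCC adj4 W ≤ (n ^ 2 + (n - 1) ^ 2 : ℕ) ∧
      ((n ^ 2 + (n - 1) ^ 2 : ℕ) : ℝ) / (2 * n ^ 2 : ℕ) ≤ density W := by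
  have : NeZero (2 * n * n) := ⟨by positivity⟩
  obtain ⟨W, hW, hd⟩ := exists_density_of_isSeparated_single sub_mem_disp4 (by decide)
    isCoprime_one_right (isSeparated_diamond n)
  rw [card_diamond] at hW hd
  exact ⟨W, hW, by rwa [mul_assoc, ← sq] at hd⟩

end Rectangles

section Tables

/-! ### Two sporadic periodic images -/

theorem isSeparated_residue_iff {ι : Type*} {D : Finset (ℤ × ℤ)} {P : ι → Finset (ℤ × ℤ)} {N : ℕ}
    {α β : ℤ} :
    IsSeparated D (residue N α β) P ↔ ∀ i j, ∀ p ∈ P i, ∀ q ∈ P j, ∀ d ∈ D,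
      (N : ℤ) ∣ α * (q.1 - p.1 - d.1) + β * (q.2 - p.2 - d.2) → i = j ∧ q = p + d := by
  simp only [IsSeparated, residue_eq_add_iff]

/-- Four L-trominoes and a single pixel. -/
def shapes24 : Fin 5 → Finset (ℤ × ℤ) :=
  ![
    {(1, -1), (1, 0), (2, 0)},
    {(4, 0), (3, 1), (4, 1)},
    {(7, -1), (8, -1), (8, 0)},
    {(10, -1), (11, -1), (10, 0)},
    {(19, 0)}]

/-- Polyominoes of sizes 10, 10, 8, 8, 10, 10 and 5. -/
def shapes90 : Fin 7 → Finset (ℤ × ℤ) :=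
  ![
    {(-1, -1), (-2, 0), (-1, 0), (0, 0), (-3, 1), (-2, 1), (-1, 1), (0, 1), (-2, 2), (-1, 2)},
    {(3, -1), (2, 0), (3, 0), (4, 0), (2, 1), (3, 1), (4, 1), (5, 1), (3, 2), (4, 2)},
    {(5, -3), (4, -2), (5, -2), (6, -2), (5, -1), (6, -1), (7, -1), (6, 0)},
    {(10, -2), (9, -1), (10, -1), (11, -1), (8, 0), (9, 0), (10, 0), (9, 1)},
    {(15, -3), (16, -3), (14, -2), (15, -2), (16, -2), (17, -2), (15, -1), (16, -1), (17, -1),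
      (16, 0)},
    {(20, -3), (21, -3), (19, -2), (20, -2), (21, -2), (22, -2), (19, -1), (20, -1), (21, -1),
      (20, 0)},
    {(34, -1), (33, 0), (34, 0), (35, 0), (34, 1)}]

theorem exists_density_thirteen_div : ∃ W, maxCC adj4 W ≤ 3 ∧ (13 / 24 : ℝ) ≤ density W := by
  have hsep : IsSeparated disp4 (residue 24 1 19) shapes24 :=
    isSeparated_residue_iff.2 (by decide +kernel)
  have hsum : ∑ i, #(shapes24 i) = 13 := by decide +kernel
  have h := exists_density_of_isSeparated sub_mem_disp4 (by decide) isCoprime_one_left hsep (k := 3)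
    (by decide +kernel)
  exact_mod_cast hsum ▸ h

theorem exists_density_sixtyOne_div : ∃ W, maxCC adj4 W ≤ 10 ∧ (61 / 90 : ℝ) ≤ density W := by
  have hsep : IsSeparated disp4 (residue 90 1 41) shapes90 :=
    isSeparated_residue_iff.2 (by decide +kernel)
  have hsum : ∑ i, #(shapes90 i) = 61 := by decide +kernel
  have h := exists_density_of_isSeparated sub_mem_disp4 (by decide) isCoprime_one_left hsep
    (k := 10) (by decide +kernel)
  exact_mod_cast hsum ▸ h

end Tables

section InverseFunctions

/-! ### The functions `F₈`, `F₄` and their inverses -/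

variable {d : ℝ} {j s : ℕ}

theorem isLeast_of_isLeast_sSup_image_Icc {f : ℕ → ℝ} {k : ℕ}
    (hk : IsLeast {k : ℕ | 1 ≤ k ∧ d ≤ sSup (f '' Set.Icc 1 k)} k) :
    IsLeast {j : ℕ | 1 ≤ j ∧ d ≤ f j} k := by
  have hfin (n : ℕ) : (f '' Set.Icc 1 n).Finite := (Set.finite_Icc 1 n).image f
  have hmin : k ∈ lowerBounds {j : ℕ | 1 ≤ j ∧ d ≤ f j} := fun j hj =>
    hk.2 ⟨hj.1, hj.2.trans (le_csSup (hfin j).bddAbove (Set.mem_image_of_mem f ⟨hj.1, le_rfl⟩))⟩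
  have hne : (f '' Set.Icc 1 k).Nonempty := ⟨f 1, 1, ⟨le_rfl, hk.1.1⟩, rfl⟩
  obtain ⟨j, hj, hmax⟩ := hne.csSup_mem (hfin k)
  have hdj : d ≤ f j := hmax ▸ hk.1.2
  obtain rfl : j = k := le_antisymm hj.2 (hmin ⟨hj.1, hdj⟩)
  exact ⟨⟨hj.1, hdj⟩, hmin⟩

theorem isLeast_sInf_le_sSup_image_Icc {f : ℕ → ℝ} (hf : ∃ j, 1 ≤ j ∧ d ≤ f j) :
    IsLeast {k : ℕ | 1 ≤ k ∧ d ≤ sSup (f '' Set.Icc 1 k)}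
      (sInf {k : ℕ | 1 ≤ k ∧ d ≤ sSup (f '' Set.Icc 1 k)}) := by
  obtain ⟨j, hj, hdj⟩ := hf
  have hbdd : BddAbove (f '' Set.Icc 1 j) := ((Set.finite_Icc 1 j).image f).bddAbove
  have hmem : j ∈ {k : ℕ | 1 ≤ k ∧ d ≤ sSup (f '' Set.Icc 1 k)} :=
    ⟨hj, hdj.trans (le_csSup hbdd (Set.mem_image_of_mem f ⟨hj, le_rfl⟩))⟩
  exact ⟨Nat.sInf_mem ⟨j, hmem⟩, fun k hk => Nat.sInf_le hk⟩

theorem div_le_f8 (h : 4 * j ≤ s ^ 2) : (j : ℝ) / (j + s + 1) ≤ f8 j := by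
  have hceil : ⌈2 * √(j : ℝ)⌉ ≤ (s : ℤ) := ceil_two_mul_sqrt_le_iff.2 (by exact_mod_cast h)
  have hceil' : (⌈2 * √(j : ℝ)⌉ : ℝ) ≤ s := by exact_mod_cast hceil
  have := ceil_two_mul_sqrt_nonneg j
  exact div_le_div_of_nonneg_left (by positivity) (by positivity) (by linarith)

theorem div_le_f4 (hj : 1 ≤ j) (h : 8 * j ≤ s ^ 2 + 4) : (j : ℝ) / (j + s / 2) ≤ f4 j := by
  have h' : (8 * j : ℝ) ≤ s ^ 2 + 4 := by exact_mod_cast h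
  have hceil : ⌈2 * √(2 * (j : ℝ) - 1)⌉ ≤ (s : ℤ) := ceil_two_mul_sqrt_le_iff.2 (by linarith)
  have hceil' : (⌈2 * √(2 * (j : ℝ) - 1)⌉ : ℝ) ≤ s := by exact_mod_cast hceil
  have := ceil_two_mul_sqrt_nonneg (2 * j - 1)
  exact div_le_div_of_nonneg_left (by positivity) (by positivity) (by linarith)

theorem f4_le_div (hj : 1 ≤ j) (h : s ^ 2 + 4 < 8 * j) : f4 j ≤ (j : ℝ) / (j + (s + 1) / 2) := by
  have h' : (s ^ 2 + 4 : ℝ) < 8 * j := by exact_mod_cast h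
  have hceil : ¬ ⌈2 * √(2 * (j : ℝ) - 1)⌉ ≤ (s : ℤ) := by
    rw [ceil_two_mul_sqrt_le_iff]
    linarith
  have hceil' : (s + 1 : ℝ) ≤ ⌈2 * √(2 * (j : ℝ) - 1)⌉ := by
    exact_mod_cast Int.add_one_le_of_lt (not_le.1 hceil)
  exact div_le_div_of_nonneg_left (by positivity) (by positivity) (by linarith)

theorem exists_le_f8 (hd : d < 1) : ∃ j, 1 ≤ j ∧ d ≤ f8 j := by
  have hd' : 0 < 1 - d := sub_pos.2 hd
  obtain ⟨n, hn⟩ := exists_nat_gt (2 / (1 - d))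
  have hn0 : 0 < n := by exact_mod_cast (div_pos two_pos hd').trans hn
  rw [div_lt_iff₀ hd'] at hn
  have hn1 : (1 : ℝ) ≤ n := by exact_mod_cast hn0
  refine ⟨n ^ 2, Nat.one_le_pow _ _ hn0, le_trans ?_ (div_le_f8 (s := 2 * n) (by lia))⟩
  push_cast
  rw [le_div_iff₀ (by positivity)]
  nlinarith [hn1]

theorem exists_le_f4 (hd : d < 1) : ∃ j, 1 ≤ j ∧ d ≤ f4 j := by
  have hd' : 0 < 1 - d := sub_pos.2 hd
  obtain ⟨n, hn⟩ := exists_nat_gt (2 / (1 - d))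
  have hn0 : 0 < n := by exact_mod_cast (div_pos two_pos hd').trans hn
  rw [div_lt_iff₀ hd'] at hn
  have hn2 : 1 ≤ 2 * n ^ 2 := Nat.succ_le_of_lt (by positivity)
  refine ⟨2 * n ^ 2, hn2, le_trans ?_ (div_le_f4 (s := 4 * n) hn2 (by lia))⟩
  push_cast
  rw [le_div_iff₀ (by positivity)]
  nlinarith

theorem isLeast_F8inv (hd : d < 1) : IsLeast {k : ℕ | 1 ≤ k ∧ d ≤ F8 k} (F8inv d) :=
  isLeast_sInf_le_sSup_image_Icc (exists_le_f8 hd)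

theorem isLeast_F4inv (hd : d < 1) : IsLeast {k : ℕ | 1 ≤ k ∧ d ≤ F4 k} (F4inv d) :=
  isLeast_sInf_le_sSup_image_Icc (exists_le_f4 hd)

theorem isLeast_le_f8_F8inv (hd : d < 1) : IsLeast {j : ℕ | 1 ≤ j ∧ d ≤ f8 j} (F8inv d) :=
  isLeast_of_isLeast_sSup_image_Icc (isLeast_F8inv hd)

theorem isLeast_le_f4_F4inv (hd : d < 1) : IsLeast {j : ℕ | 1 ≤ j ∧ d ≤ f4 j} (F4inv d) :=
  isLeast_of_isLeast_sSup_image_Icc (isLeast_F4inv hd)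

theorem mul_sub_le_of_le {A B t T R : ℝ} (hA : 0 ≤ A) (hR : 0 ≤ R) (ht : 0 ≤ t) (htT : t ≤ T)
    (hT : T * (A * T - B) ≤ R) : t * (A * t - B) ≤ R := by
  have hmono : A * t - B ≤ A * T - B := by gcongr
  rcases le_total (A * t - B) 0 with hneg | hpos
  · exact (mul_nonpos_of_nonneg_of_nonpos ht hneg).trans hR
  · exact (mul_le_mul htT hmono hpos (ht.trans htT)).trans hT

theorem div_sq_sub_div_le {A B x w : ℝ} (hd : d < 1) (hA : 0 ≤ A) (hx : 0 ≤ x) (hw : 0 < w)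
    (hdx : d ≤ x / (x + w)) (hpoly : (x + w) * (A * (x + w) - B * w) ≤ x * w ^ 2) :
    A / (1 - d) ^ 2 - B / (1 - d) ≤ x := by
  have hd' : 0 < 1 - d := sub_pos.2 hd
  have hinv : 1 / (1 - d) ≤ (x + w) / w := by
    rw [le_div_iff₀ (by positivity)] at hdx
    rw [div_le_div_iff₀ hd' hw]
    linarith
  calc A / (1 - d) ^ 2 - B / (1 - d) = 1 / (1 - d) * (A * (1 / (1 - d)) - B) := by field_simp
    _ ≤ x := mul_sub_le_of_le hA hx (by positivity) hinv (by
      have : (x + w) / w * (A * ((x + w) / w) - B) = (x + w) * (A * (x + w) - B * w) / w ^ 2 := by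
        field_simp
      rwa [this, div_le_iff₀ (by positivity)])

theorem le_F8inv (hd : d < 1) : 4 / (1 - d) ^ 2 - 6 / (1 - d) ≤ F8inv d := by
  obtain ⟨-, hdk⟩ := (isLeast_le_f8_F8inv hd).1
  generalize F8inv d = k at hdk ⊢
  have hsq : √(k : ℝ) ^ 2 = k := Real.sq_sqrt (by positivity)
  have hr : 0 ≤ √(k : ℝ) := Real.sqrt_nonneg _
  have hle : f8 k ≤ k / (k + (2 * √(k : ℝ) + 1)) :=
    div_le_div_of_nonneg_left (by positivity) (by positivity)
      (by linarith [Int.le_ceil (2 * √(k : ℝ))])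
  refine div_sq_sub_div_le hd (by norm_num) (by positivity) (by positivity) (hdk.trans hle) ?_
  rw [← hsq, Real.sqrt_sq hr]
  nlinarith

theorem le_F4inv (hd : d < 1) : 2 / (1 - d) ^ 2 - 4 / (1 - d) ≤ F4inv d := by
  obtain ⟨hk, hdk⟩ := (isLeast_le_f4_F4inv hd).1
  generalize F4inv d = k at hk hdk ⊢
  have hk' : (1 : ℝ) ≤ k := by exact_mod_cast hk
  have hsq : √(2 * (k : ℝ) - 1) ^ 2 = 2 * k - 1 := Real.sq_sqrt (by linarith)
  have hr : 0 < √(2 * (k : ℝ) - 1) := Real.sqrt_pos.2 (by linarith)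
  have hle : f4 k ≤ k / (k + √(2 * (k : ℝ) - 1)) :=
    div_le_div_of_nonneg_left (by positivity) (by positivity)
      (by linarith [Int.le_ceil (2 * √(2 * (k : ℝ) - 1))])
  refine div_sq_sub_div_le hd (by norm_num) (by positivity) hr (hdk.trans hle) ?_
  rw [hsq]
  nlinarith

end InverseFunctions

section GuaranteedSize

/-! ### Bounds for the guaranteed component size -/

variable {G : SimpleGraph (ℤ × ℤ)} {W : Set (ℤ × ℤ)} {d ρ : ℝ} {j k : ℕ}

theorem mgcs_le (hd : d ≤ ρ) (h : ∃ W, maxCC G W ≤ k ∧ ρ ≤ density W) : mgcs G d ≤ k := by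
  obtain ⟨W, hsize, hdens⟩ := h
  have hle : mgcs G d ≤ maxCC G W := sInf_le ⟨W, hd.trans hdens, rfl⟩
  exact hle.trans hsize

theorem add_one_le_mgcs (h : ∀ W, maxCC G W ≤ k → density W < d) :
    ((k + 1 : ℕ) : ℕ∞) ≤ mgcs G d := by
  refine le_sInf ?_
  rintro _ ⟨W, hW, rfl⟩
  by_contra! hlt
  exact (h W (Order.le_of_lt_add_one (by exact_mod_cast hlt))).not_ge hW

theorem mgcs_eq_add_one (hd : d ≤ ρ) (hlow : ∀ W, maxCC G W ≤ k → density W < d)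
    (hup : ∃ W, maxCC G W ≤ (k + 1 : ℕ) ∧ ρ ≤ density W) : mgcs G d = (k + 1 : ℕ) :=
  le_antisymm (mgcs_le hd hup) (add_one_le_mgcs hlow)

theorem exists_pos_lt_forall_le {f : ℕ → ℝ} (hd : 0 < d) (h : ∀ j, 1 ≤ j → j ≤ k → f j < d) :
    ∃ ρ, 0 < ρ ∧ ρ < d ∧ ∀ j, 1 ≤ j → j ≤ k → f j ≤ ρ := by
  have hle : ∀ᶠ ρ in 𝓝[<] d, ∀ j ∈ Set.Icc 1 k, f j ≤ ρ :=
    (Set.finite_Icc 1 k).eventually_all.2 fun j hj =>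
      (eventually_ge_nhds (h j hj.1 hj.2)).filter_mono nhdsWithin_le_nhds
  have hmem : ∀ᶠ ρ in 𝓝[<] d, ρ ∈ Set.Ioo 0 d := Ioo_mem_nhdsLT hd
  obtain ⟨ρ, hρ, hρ0, hρd⟩ := (hle.and hmem).exists
  exact ⟨ρ, hρ0, hρd, fun j hj hjk => hρ j ⟨hj, hjk⟩⟩

theorem density_lt_of_f8_lt (hW : maxCC adj8 W ≤ k) (hd : 0 < d)
    (h : ∀ j, 1 ≤ j → j ≤ k → f8 j < d) : density W < d := by
  obtain ⟨ρ, hρ0, hρd, hρ⟩ := exists_pos_lt_forall_le hd h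
  exact (density_le_of_f8_le (maxCC_le_iff.1 hW) hρ0.le hρ).trans_lt hρd

theorem density_lt_of_f4_lt (hW : maxCC adj4 W ≤ k) (hd : 0 < d)
    (h : ∀ j, 1 ≤ j → j ≤ k → f4 j < d) : density W < d := by
  obtain ⟨ρ, hρ0, hρd, hρ⟩ := exists_pos_lt_forall_le hd h
  exact (density_le_of_f4_le (maxCC_le_iff.1 hW) hρ0 hρ).trans_lt hρd

theorem F8inv_le_C8 (hd0 : 0 < d) (hd1 : d < 1) : (F8inv d : ℕ∞) ≤ C8 d := by
  obtain ⟨⟨hpos, -⟩, hmin⟩ := isLeast_le_f8_F8inv hd1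
  rw [← Nat.sub_add_cancel hpos]
  refine add_one_le_mgcs fun W hW => density_lt_of_f8_lt hW hd0 fun j hj hjk => ?_
  by_contra! hdj
  have := hmin ⟨hj, hdj⟩
  lia

theorem F4inv_le_C4 (hd0 : 0 < d) (hd1 : d < 1) : (F4inv d : ℕ∞) ≤ C4 d := by
  obtain ⟨⟨hpos, -⟩, hmin⟩ := isLeast_le_f4_F4inv hd1
  rw [← Nat.sub_add_cancel hpos]
  refine add_one_le_mgcs fun W hW => density_lt_of_f4_lt hW hd0 fun j hj hjk => ?_
  by_contra! hdj
  have := hmin ⟨hj, hdj⟩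
  lia

theorem exists_mul_add_eq {s : ℕ} (hj : 1 ≤ j) (h : 4 * j ≤ s ^ 2) :
    ∃ a b p, p ≤ a ∧ a * b + p = j ∧ a + b + 1 ≤ s := by
  have hs : 2 ≤ s := by nlinarith
  have hpos : 0 < s / 2 := by lia
  have hle : j ≤ (s / 2) * (s - s / 2) := by
    rcases Nat.even_or_odd' s with ⟨t, rfl | rfl⟩
    · rw [show 2 * t / 2 = t by lia, show 2 * t - t = t by lia]
      nlinarith
    · rw [show (2 * t + 1) / 2 = t by lia, show 2 * t + 1 - t = t + 1 by lia]
      nlinarith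
  have hdiv : (j - 1) / (s / 2) < s - s / 2 := by
    rw [Nat.div_lt_iff_lt_mul hpos, mul_comm]
    lia
  refine ⟨s / 2, (j - 1) / (s / 2), (j - 1) % (s / 2) + 1, Nat.mod_lt _ hpos, ?_, by lia⟩
  rw [← add_assoc, Nat.div_add_mod, Nat.sub_add_cancel hj]

theorem exists_density_f8 (hj : 1 ≤ j) : ∃ W, maxCC adj8 W ≤ j ∧ f8 j ≤ density W := by
  obtain ⟨s, hs⟩ := Int.eq_ofNat_of_zero_le (Int.ceil_nonneg (by positivity : 0 ≤ 2 * √(j : ℝ)))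
  have hsq : 4 * j ≤ s ^ 2 := by exact_mod_cast ceil_two_mul_sqrt_le_iff.1 hs.le
  obtain ⟨a, b, p, hp, rfl, hab⟩ := exists_mul_add_eq hj hsq
  obtain ⟨W, hsize, hdens⟩ := exists_density_rectShape a b hp
  refine ⟨W, hsize, le_trans ?_ hdens⟩
  rw [f8, hs]
  push_cast
  gcongr
  exact_mod_cast hab

theorem C8_eq_F8inv (hd0 : 0 < d) (hd1 : d < 1) : C8 d = F8inv d := by
  obtain ⟨hpos, hle⟩ := (isLeast_le_f8_F8inv hd1).1
  exact le_antisymm (mgcs_le hle (exists_density_f8 hpos)) (F8inv_le_C8 hd0 hd1)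

end GuaranteedSize

section ExactIntervals

/-! ### Intervals on which `C₄ = F₄⁻¹` -/

variable {d : ℝ} {j j₀ k k₁ m n s s₀ u : ℕ}

theorem mul_le_mul_of_sq_bounds (hj : 1 ≤ j) (hjj : j ≤ j₀) (hs : 8 * j ≤ s ^ 2 + 4)
    (hs₀ : 5 ≤ s₀) (hj₀ : 8 * j₀ + 1 = s₀ ^ 2) : j * s₀ ≤ j₀ * s := by
  rcases Nat.lt_or_ge s s₀ with hlt | hge
  · rcases Nat.lt_or_ge s 5 with h5 | h5
    · have hs2 : 2 ≤ s := by nlinarith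
      have hj2 : 2 * j ≤ s := by interval_cases s <;> lia
      nlinarith
    · suffices 8 * (j * s₀) ≤ 8 * (j₀ * s) by lia
      obtain ⟨t, rfl⟩ := Nat.exists_eq_add_of_lt hlt
      nlinarith [Nat.mul_le_mul_right (s + t + 1) hs, Nat.mul_le_mul h5 hlt]
  · exact Nat.mul_le_mul hjj hge

theorem f4_le_of_le_triangular (hj : 1 ≤ j) (hjj : j ≤ j₀) (hu : 2 ≤ u)
    (hj₀ : 2 * j₀ = u * (u + 1)) : f4 j ≤ (j₀ : ℝ) / (j₀ + (u + 1 / 2)) := by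
  obtain ⟨s, hs⟩ :=
    Int.eq_ofNat_of_zero_le (Int.ceil_nonneg (by positivity : 0 ≤ 2 * √(2 * (j : ℝ) - 1)))
  have hsq : (4 * (2 * j - 1) : ℝ) ≤ s ^ 2 := ceil_two_mul_sqrt_le_iff.1 hs.le
  have hsq' : 8 * j ≤ s ^ 2 + 4 := by
    have : (8 * j : ℝ) ≤ s ^ 2 + 4 := by linarith
    exact_mod_cast this
  have hmul : (j * (2 * u + 1) : ℝ) ≤ j₀ * s := by
    exact_mod_cast mul_le_mul_of_sq_bounds hj hjj hsq' (by lia) (by lia : _ = (2 * u + 1) ^ 2)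
  rw [f4, hs, div_le_div_iff₀ (by positivity) (by positivity)]
  push_cast
  linarith

theorem C4_eq_F4inv_of_constructions (hu : 2 ≤ u) (hj₀ : 2 * j₀ = u * (u + 1))
    (hk₁ : 2 * k₁ ≤ (u + 1) ^ 2 + 1) (hlow : (j₀ : ℝ) / (j₀ + (u + 1 / 2)) < d)
    (hup : d ≤ (k₁ : ℝ) / (k₁ + (u + 1)))
    (hW : ∀ k, j₀ < k → k ≤ k₁ →
      ∃ W, maxCC adj4 W ≤ k ∧ (k : ℝ) / (k + (u + 1)) ≤ density W) :
    C4 d = F4inv d := by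
  have hd0 : 0 < d := lt_of_le_of_lt (by positivity) hlow
  have hd1 : d < 1 := hup.trans_lt (by rw [div_lt_one (by positivity)]; linarith)
  obtain ⟨⟨hpos, hle⟩, hmin⟩ := isLeast_le_f4_F4inv hd1
  have hk₀ : j₀ < F4inv d := by
    by_contra! hc
    exact (hle.trans (f4_le_of_le_triangular hpos hc hu hj₀)).not_gt hlow
  have hkle : F4inv d ≤ k₁ := by
    have hk₁pos : 1 ≤ k₁ := by
      by_contra! hc
      obtain rfl : k₁ = 0 := by lia
      exact absurd hup (by simpa using hd0)
    have hf4 := div_le_f4 (s := 2 * (u + 1)) hk₁pos (by lia)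
    push_cast at hf4
    rw [mul_div_cancel_left₀ _ two_ne_zero] at hf4
    exact hmin ⟨hk₁pos, hup.trans hf4⟩
  have hf4 : f4 (F4inv d) ≤ (F4inv d : ℝ) / (F4inv d + (u + 1)) := by
    convert f4_le_div (s := 2 * u + 1) hpos (by lia) using 3
    push_cast
    ring
  exact le_antisymm (mgcs_le (hle.trans hf4) (hW _ hk₀ hkle)) (F4inv_le_C4 hd0 hd1)

theorem exists_density_of_le_diamond (hm : 1 ≤ m) (hlow : 2 * m ^ 2 + m < k)
    (hup : k ≤ 2 * m ^ 2 + 2 * m + 1) :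
    ∃ W, maxCC adj4 W ≤ k ∧ (k : ℝ) / (k + (2 * m + 1)) ≤ density W := by
  rcases eq_or_lt_of_le hup with rfl | hlt
  · have hcard : (m + 1) ^ 2 + (m + 1 - 1) ^ 2 = 2 * m ^ 2 + 2 * m + 1 := by lia
    have h := exists_density_diamond (n := m + 1) (by lia)
    rw [hcard] at h
    convert h using 6
    push_cast
    ring
  · have hcard : 2 * m * (m + 1) - (2 * m ^ 2 + 2 * m - k) = k := by lia
    have h := exists_density_diagRectShape hm (Nat.le_add_left 1 m)
      (m := 2 * m ^ 2 + 2 * m - k) (by lia)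
    rw [hcard] at h
    convert h using 6
    push_cast
    ring

theorem exists_density_of_le_square (hn : 1 ≤ n) (hlow : 2 * n ^ 2 < k + n)
    (hup : k ≤ 2 * n ^ 2) :
    ∃ W, maxCC adj4 W ≤ k ∧ (k : ℝ) / (k + 2 * n) ≤ density W := by
  have hcard : 2 * n * n - (2 * n ^ 2 - k) = k := by lia
  have h := exists_density_diagRectShape hn hn (m := 2 * n ^ 2 - k) (by lia)
  rw [hcard] at h
  convert h using 6
  push_cast
  ring

theorem C4_eq_F4inv_of_diamond (hn : 2 ≤ n)
    (hd : d ∈ Set.Ioc ((4 * (n : ℝ) ^ 2 - 6 * n + 2) / (4 * (n : ℝ) ^ 2 - 2 * n - 1))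
      ((((n : ℝ) - 1) ^ 2 + (n : ℝ) ^ 2) / (2 * (n : ℝ) ^ 2))) : C4 d = F4inv d := by
  obtain ⟨m, rfl⟩ := Nat.exists_eq_add_of_le' (one_le_two.trans hn)
  have hm : 1 ≤ m := by lia
  have hm' : (1 : ℝ) ≤ m := by exact_mod_cast hm
  obtain ⟨hlow, hup⟩ := hd
  refine C4_eq_F4inv_of_constructions (u := 2 * m) (j₀ := 2 * m ^ 2 + m)
    (k₁ := 2 * m ^ 2 + 2 * m + 1) (by lia) (by ring) (by lia) (hlow.trans_eq' ?_)
    (hup.trans_eq ?_) fun k hlow hup => by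
      exact_mod_cast exists_density_of_le_diamond hm hlow hup
  · push_cast
    have hden : 0 < 4 * ((m : ℝ) + 1) ^ 2 - 2 * (m + 1) - 1 := by nlinarith
    rw [div_eq_div_iff hden.ne' (by positivity)]
    ring
  · push_cast
    rw [div_eq_div_iff (by positivity) (by positivity)]
    ring

theorem C4_eq_F4inv_of_square (hn : 2 ≤ n)
    (hd : d ∈ Set.Ioc ((4 * (n : ℝ) ^ 2 - 2 * n) / (4 * (n : ℝ) ^ 2 + 2 * n - 1))
      ((n : ℝ) / ((n : ℝ) + 1))) : C4 d = F4inv d := by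
  obtain ⟨m, rfl⟩ := Nat.exists_eq_add_of_le' (one_le_two.trans hn)
  obtain ⟨hlow, hup⟩ := hd
  refine C4_eq_F4inv_of_constructions (u := 2 * m + 1) (j₀ := (2 * m + 1) * (m + 1))
    (k₁ := 2 * (m + 1) ^ 2) (by lia) (by ring) (by lia) (hlow.trans_eq' ?_)
    (hup.trans_eq ?_) fun k hlow hup => ?_
  · push_cast
    have hden : 0 < 4 * ((m : ℝ) + 1) ^ 2 + 2 * (m + 1) - 1 := by nlinarith
    rw [div_eq_div_iff hden.ne' (by positivity)]
    ring
  · push_cast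
    rw [div_eq_div_iff (by positivity) (by positivity)]
    ring
  · convert exists_density_of_le_square (n := m + 1) (by lia) (by lia) hup using 6
    push_cast
    ring

end ExactIntervals

section SmallValues

/-! ### The first values of `C₄` -/

variable {d : ℝ} {j : ℕ}

theorem f4_le_div_natSqrt (hj : 1 ≤ j) :
    f4 j ≤ (j : ℝ) / (j + (Nat.sqrt (8 * j - 5) + 1) / 2) :=
  f4_le_div hj (by have := Nat.sqrt_le' (8 * j - 5); lia)

theorem C4_eq_one (hd : d ∈ Set.Ioc (0 : ℝ) (1 / 2)) : C4 d = 1 := by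
  refine mgcs_eq_add_one (k := 0) hd.2 (fun W hW => density_lt_of_f4_lt hW hd.1 (by lia)) ?_
  simpa using exists_density_diamond le_rfl

theorem C4_eq_three (hd : d ∈ Set.Ioc (1 / 2 : ℝ) (13 / 24)) : C4 d = 3 := by
  refine mgcs_eq_add_one (k := 2) hd.2 (fun W hW => ?_) exists_density_thirteen_div
  refine (density_le_of_f4_le (maxCC_le_iff.1 hW) one_half_pos fun j hj hj2 => ?_).trans_lt hd.1
  exact (f4_le_div_natSqrt hj).trans (by interval_cases j <;> norm_num)

theorem C4_eq_four (hd : d ∈ Set.Ioc (13 / 24 : ℝ) (4 / 7)) : C4 d = 4 := by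
  refine mgcs_eq_add_one (k := 3) hd.2 (fun W hW => ?_) ?_
  · exact (density_le_of_components_card_le_three (maxCC_le_iff.1 hW)).trans_lt hd.1
  · have h := exists_density_diagRectShape (a := 1) (b := 2) (m := 0) (by simp) (by simp) (by simp)
    norm_num at h ⊢
    exact h

theorem C4_eq_five (hd : d ∈ Set.Ioc (4 / 7 : ℝ) (5 / 8)) : C4 d = 5 := by
  refine mgcs_eq_add_one (k := 4) hd.2 (fun W hW => ?_) ?_
  · refine (density_le_of_f4_le (maxCC_le_iff.1 hW) (by norm_num) fun j hj hj4 => ?_).trans_lt hd.1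
    exact (f4_le_div_natSqrt hj).trans (by interval_cases j <;> norm_num)
  · have h := exists_density_diamond (n := 2) (by simp)
    norm_num at h ⊢
    exact h

theorem C4_eq_seven (hd : d ∈ Set.Ioc (5 / 8 : ℝ) (7 / 11)) : C4 d = 7 := by
  refine mgcs_eq_add_one (k := 6) hd.2 (fun W hW => ?_) ?_
  · exact (density_le_of_components_card_le_six (maxCC_le_iff.1 hW)).trans_lt hd.1
  · have h := exists_density_diagRectShape (a := 2) (b := 2) (m := 1) (by simp) (by simp) (by simp)
    norm_num at h ⊢
    exact h

theorem C4_eq_eight (hd : d ∈ Set.Ioc (7 / 11 : ℝ) (2 / 3)) : C4 d = 8 := by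
  refine mgcs_eq_add_one (k := 7) hd.2 (fun W hW => ?_) ?_
  · refine (density_le_of_f4_le (maxCC_le_iff.1 hW) (by norm_num) fun j hj hj7 => ?_).trans_lt hd.1
    exact (f4_le_div_natSqrt hj).trans (by interval_cases j <;> norm_num)
  · have h := exists_density_diagRectShape (a := 2) (b := 2) (m := 0) (by simp) (by simp) (by simp)
    norm_num at h ⊢
    exact h

theorem C4_eq_ten (hd : d ∈ Set.Ioc (2 / 3 : ℝ) (61 / 90)) : C4 d = 10 := by
  refine mgcs_eq_add_one (k := 9) hd.2 (fun W hW => ?_) exists_density_sixtyOne_div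
  refine (density_le_of_f4_le (maxCC_le_iff.1 hW) (by norm_num) fun j hj hj9 => ?_).trans_lt hd.1
  exact (f4_le_div_natSqrt hj).trans (by interval_cases j <;> norm_num)

end SmallValues

end BinaryImage

theorem corollary1p2 :
    (∀ d ∈ Set.Ioo (0 : ℝ) 1,
      -- the minima defining `F₈⁻¹(d)` and `F₄⁻¹(d)` exist
      (IsLeast {k : ℕ | 1 ≤ k ∧ d ≤ BinaryImage.F8 k} (BinaryImage.F8inv d) ∧
        IsLeast {k : ℕ | 1 ≤ k ∧ d ≤ BinaryImage.F4 k} (BinaryImage.F4inv d)) ∧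
      (BinaryImage.C8 d = (BinaryImage.F8inv d : ℕ∞) ∧
        4 / (1 - d) ^ 2 - 6 / (1 - d) ≤ (BinaryImage.F8inv d : ℝ)) ∧
      ((BinaryImage.F4inv d : ℕ∞) ≤ BinaryImage.C4 d ∧
        2 / (1 - d) ^ 2 - 4 / (1 - d) ≤ (BinaryImage.F4inv d : ℝ))) ∧
    -- exact values of `C₄`
    (∀ d ∈ Set.Ioc (0 : ℝ) (1 / 2), BinaryImage.C4 d = 1) ∧
    (∀ d ∈ Set.Ioc (1 / 2 : ℝ) (13 / 24), BinaryImage.C4 d = 3) ∧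
    (∀ d ∈ Set.Ioc (13 / 24 : ℝ) (4 / 7), BinaryImage.C4 d = 4) ∧
    (∀ d ∈ Set.Ioc (4 / 7 : ℝ) (5 / 8), BinaryImage.C4 d = 5) ∧
    (∀ d ∈ Set.Ioc (5 / 8 : ℝ) (7 / 11), BinaryImage.C4 d = 7) ∧
    (∀ d ∈ Set.Ioc (7 / 11 : ℝ) (2 / 3), BinaryImage.C4 d = 8) ∧
    (∀ d ∈ Set.Ioc (2 / 3 : ℝ) (61 / 90), BinaryImage.C4 d = 10) ∧
    (∀ n : ℕ, 2 ≤ n →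
      ∀ d ∈ Set.Ioc ((4 * (n : ℝ) ^ 2 - 6 * n + 2) / (4 * (n : ℝ) ^ 2 - 2 * n - 1))
          ((((n : ℝ) - 1) ^ 2 + (n : ℝ) ^ 2) / (2 * (n : ℝ) ^ 2)),
        BinaryImage.C4 d = (BinaryImage.F4inv d : ℕ∞)) ∧
    (∀ n : ℕ, 2 ≤ n →
      ∀ d ∈ Set.Ioc ((4 * (n : ℝ) ^ 2 - 2 * n) / (4 * (n : ℝ) ^ 2 + 2 * n - 1))
          ((n : ℝ) / ((n : ℝ) + 1)),
        BinaryImage.C4 d = (BinaryImage.F4inv d : ℕ∞)) := by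
  refine ⟨fun d hd => ⟨⟨BinaryImage.isLeast_F8inv hd.2, BinaryImage.isLeast_F4inv hd.2⟩,
      ⟨BinaryImage.C8_eq_F8inv hd.1 hd.2, BinaryImage.le_F8inv hd.2⟩,
      BinaryImage.F4inv_le_C4 hd.1 hd.2, BinaryImage.le_F4inv hd.2⟩,
    fun d hd => BinaryImage.C4_eq_one hd,
    fun d hd => BinaryImage.C4_eq_three hd,
    fun d hd => BinaryImage.C4_eq_four hd,
    fun d hd => BinaryImage.C4_eq_five hd,
    fun d hd => BinaryImage.C4_eq_seven hd,
    fun d hd => BinaryImage.C4_eq_eight hd,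
    fun d hd => BinaryImage.C4_eq_ten hd,
    fun n hn d hd => BinaryImage.C4_eq_F4inv_of_diamond hn hd,
    fun n hn d hd => BinaryImage.C4_eq_F4inv_of_square hn hd⟩
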